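/- Let $m\ge 1$ be an integer, let $p_1,\dots,p_m>0$ be real numbers, and let $$\Omega_1=\Big\{z\in\mathbb C^m:\ \sum_{j=1}^m |z_j|^{2p_j}<1\Big\}.$$ Let $L^2_a(\Omega_1)$ be the Bergman space, that is, the Hilbert space of holomorphic functions on $\Omega_1$ that are square-integrable with respect to Lebesgue measure, and let $M_{z_j}f=z_jf$ be the coordinate multiplication operators on $L^2_a(\Omega_1)$, $j=1,\dots,m$. For $0<p<\infty$, an operator $T$ on a Hilbert space is called (Schatten) $p$-summable if $(TT^*)^{p/2}$ is trace class; a commuting tuple $(T_1,\dots,T_m)$ is called $p$-essentially normal if all the commutators $[T_j,T_k^*]$, $j,k=1,\dots,m$, are $p$-summable. Then, for every real $p>0$, the tuple $(M_{z_1},\dots,M_{z_m})$ is $p$-essentially normal if and only if $$p>\begin{cases}\tfrac12, & m=1,\\[2pt] \max\{m,\ p_j(m-1): j=1,\dots,m\}, & m>1.\end{cases}$$ -/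

import Mathlib

open MeasureTheory
open scoped ENNReal

universe u

/-- A bounded operator `A` on a Hilbert space is trace class if `∑ ⟨e_i, |A| e_i⟩ < ∞` for an
orthonormal basis `e`, where `|A| = (A^* A)^{1/2}`.  (The terms are nonnegative, and the sum does
not depend on the basis.) -/
def IsTraceClass {H : Type u} [NormedAddCommGroup H] [InnerProductSpace ℂ H] [CompleteSpace H]
    (A : H →L[ℂ] H) : Prop :=
  ∃ (ι : Type u) (e : HilbertBasis ι ℂ H),
    Summable fun i => (inner ℂ (e i) (CFC.abs A (e i))).re

/-- `T` is (Schatten) `q`-summable if `(T T^*)^{q/2}` is trace class; the power is that of the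
continuous functional calculus. -/
def IsSchattenSummable {H : Type u} [NormedAddCommGroup H] [InnerProductSpace ℂ H]
    [CompleteSpace H] (q : ℝ) (T : H →L[ℂ] H) : Prop :=
  IsTraceClass ((T * ContinuousLinearMap.adjoint T) ^ (q / 2))

/-- A tuple `(T_1, …, T_m)` is `q`-essentially normal if it is commuting and all the commutators
`[T_j, T_k^*]` are `q`-summable. -/
def IsEssentiallyNormal {H : Type u} [NormedAddCommGroup H] [InnerProductSpace ℂ H]
    [CompleteSpace H] {m : ℕ} (q : ℝ) (T : Fin m → H →L[ℂ] H) : Prop :=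
  (∀ j k, Commute (T j) (T k)) ∧
    ∀ j k, IsSchattenSummable q
      (T j * ContinuousLinearMap.adjoint (T k) - ContinuousLinearMap.adjoint (T k) * T j)

/-- The area mean value estimate for holomorphic functions of several variables. -/
theorem enorm_sq_mul_volume_ball_le {m : ℕ} {Ω : Set (Fin m → ℂ)}
    {g : (Fin m → ℂ) → ℂ} (hg : DifferentiableOn ℂ g Ω) {w : Fin m → ℂ} {r : ℝ}
    (hr : Metric.ball w r ⊆ Ω) :
    ‖g w‖ₑ ^ 2 * volume (Metric.ball (0 : Fin m → ℂ) r) ≤ ∫⁻ z in Ω, ‖g z‖ₑ ^ 2 := by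
  classical
  set F : (Fin m → ℂ) → ℝ≥0∞ := (Metric.ball w r).indicator (fun z => ‖g z‖ₑ ^ 2) with hF
  have hFm : Measurable F := by
    have := ((ENNReal.continuous_pow 2).comp_continuousOn
      (hg.mono hr).continuousOn.enorm).measurable_piecewise
      (g := 0) continuous_zero.continuousOn Metric.isOpen_ball.measurableSet
    rwa [Set.piecewise_eq_indicator] at this
  -- rotation invariance of Lebesgue measure
  have hrot : ∀ θ : ℝ, ∫⁻ v, F (w + circleMap 0 1 θ • v) = ∫⁻ v, F v := by
    intro θ
    have h1 : MeasurePreserving (fun z : ℂ => circleMap 0 1 θ * z) volume volume := by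
      have := (rotation (Circle.exp θ)).measurePreserving
      have he : (fun z : ℂ => circleMap 0 1 θ * z) = rotation (Circle.exp θ) := by
        funext z
        simp [rotation_apply, circleMap]
      rw [he]
      exact this
    have h2 := volume_preserving_pi (fun _ : Fin m => h1)
    rw [← lintegral_add_left_eq_self F w]
    exact h2.lintegral_comp (f := fun v => F (w + v)) (hFm.comp (measurable_const_add w))
  have hpt : ∀ v ∈ Metric.ball (0 : Fin m → ℂ) r,
      ENNReal.ofReal (2 * Real.pi) * ‖g w‖ₑ ^ 2 ≤
        ∫⁻ θ in Set.Ioc 0 (2 * Real.pi), F (w + circleMap 0 1 θ • v) := by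
    intro v hv
    have hv' : ‖v‖ < r := by simpa using hv
    have hmem : ∀ t : ℂ, ‖t‖ ≤ 1 → w + t • v ∈ Metric.ball w r := by
      intro t ht
      simp only [Metric.mem_ball, dist_self_add_left, norm_smul]
      nlinarith [norm_nonneg v, norm_nonneg t]
    have hd : DiffContOnCl ℂ (fun t : ℂ => g (w + t • v) ^ 2) (Metric.ball 0 |1|) := by
      rw [abs_one]
      refine DifferentiableOn.diffContOnCl_ball (U := Metric.closedBall 0 1) ?_ subset_rfl
      refine DifferentiableOn.pow (hg.comp (by fun_prop) ?_) 2
      intro t ht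
      exact hr (hmem t (by simpa using ht))
    have hmv := hd.circleAverage
    rw [Real.circleAverage_def, intervalIntegral.integral_of_le (by positivity)] at hmv
    simp only [zero_smul, add_zero] at hmv
    have hpi : (2 * Real.pi) ≠ 0 := by positivity
    rw [inv_smul_eq_iff₀ hpi] at hmv
    have hF' : ∀ θ : ℝ, F (w + circleMap 0 1 θ • v) = ‖g (w + circleMap 0 1 θ • v) ^ 2‖ₑ := by
      intro θ
      rw [hF, Set.indicator_of_mem (hmem _ (by simp)), enorm_pow]
    simp_rw [hF']
    refine le_trans (le_of_eq ?_) (enorm_integral_le_lintegral_enorm _)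
    rw [hmv, enorm_smul, enorm_pow, Real.enorm_eq_ofReal (by positivity)]
  have hvol : ENNReal.ofReal (2 * Real.pi) ≠ 0 := by
    simp [Real.pi_pos]
  have key : ENNReal.ofReal (2 * Real.pi) *
      (‖g w‖ₑ ^ 2 * volume (Metric.ball (0 : Fin m → ℂ) r)) ≤
      ENNReal.ofReal (2 * Real.pi) * ∫⁻ z in Ω, ‖g z‖ₑ ^ 2 := by
    calc ENNReal.ofReal (2 * Real.pi) * (‖g w‖ₑ ^ 2 * volume (Metric.ball (0 : Fin m → ℂ) r))
        = ∫⁻ _ in Metric.ball (0 : Fin m → ℂ) r, ENNReal.ofReal (2 * Real.pi) * ‖g w‖ₑ ^ 2 := by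
          rw [setLIntegral_const, mul_assoc]
      _ ≤ ∫⁻ v in Metric.ball (0 : Fin m → ℂ) r,
            ∫⁻ θ in Set.Ioc 0 (2 * Real.pi), F (w + circleMap 0 1 θ • v) :=
          setLIntegral_mono' Metric.isOpen_ball.measurableSet hpt
      _ ≤ ∫⁻ v, ∫⁻ θ in Set.Ioc 0 (2 * Real.pi), F (w + circleMap 0 1 θ • v) :=
          setLIntegral_le_lintegral _ _
      _ = ∫⁻ θ in Set.Ioc 0 (2 * Real.pi), ∫⁻ v, F (w + circleMap 0 1 θ • v) := by
          refine lintegral_lintegral_swap (Measurable.aemeasurable ?_)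
          refine hFm.comp ?_
          have : Continuous fun a : (Fin m → ℂ) × ℝ => w + circleMap 0 1 a.2 • a.1 := by
            have := continuous_circleMap 0 1
            fun_prop
          exact this.measurable
      _ = ENNReal.ofReal (2 * Real.pi) * ∫⁻ v, F v := by
          simp_rw [hrot]
          rw [setLIntegral_const, Real.volume_Ioc, sub_zero, mul_comm]
      _ ≤ _ := by
          refine mul_le_mul_right ?_ _
          rw [hF, lintegral_indicator Metric.isOpen_ball.measurableSet]
          exact lintegral_mono_set hr
  exact (ENNReal.mul_le_mul_iff_right hvol ENNReal.ofReal_ne_top).1 key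

/-- The Bergman space `L²_a(Ω)`: the subspace of `L²(Ω)` (with respect to Lebesgue measure)
of all classes that have a holomorphic representative on `Ω`. -/
def bergmanSpace {m : ℕ} (Ω : TopologicalSpace.Opens (Fin m → ℂ)) :
    Submodule ℂ (Lp ℂ 2 ((volume : Measure (Fin m → ℂ)).restrict Ω)) where
  carrier := {f | ∃ g : (Fin m → ℂ) → ℂ, DifferentiableOn ℂ g Ω ∧ f =ᵐ[volume.restrict Ω] g}
  zero_mem' := ⟨0, differentiableOn_const 0, by exact Lp.coeFn_zero ℂ 2 _⟩
  add_mem' := by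
    rintro f₁ f₂ ⟨g₁, hg₁, h₁⟩ ⟨g₂, hg₂, h₂⟩
    exact ⟨g₁ + g₂, hg₁.add hg₂, (Lp.coeFn_add f₁ f₂).trans (h₁.add h₂)⟩
  smul_mem' := by
    rintro c f ⟨g, hg, h⟩
    exact ⟨c • g, hg.const_smul c, (Lp.coeFn_smul c f).trans (h.const_smul c)⟩

/-- The Bergman space is closed in `L²(Ω)`, hence a Hilbert space. -/
theorem isClosed_bergmanSpace {m : ℕ} (Ω : TopologicalSpace.Opens (Fin m → ℂ)) :
    IsClosed (bergmanSpace Ω : Set (Lp ℂ 2 ((volume : Measure (Fin m → ℂ)).restrict Ω))) := by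
  open Filter Topology in
  refine IsSeqClosed.isClosed ?_
  intro f F hf hlim
  choose g hg hfg using hf
  have hcauchy := hlim.cauchySeq
  -- local uniform control by the `L²` norm
  have hbound : ∀ r : ℝ, 0 < r → ∃ C : ℝ, 0 < C ∧ ∀ w, Metric.ball w r ⊆ (Ω : Set (Fin m → ℂ)) →
      ∀ k l, ‖g k w - g l w‖ ≤ C * ‖f k - f l‖ := by
    intro r hr
    set V := (volume (Metric.ball (0 : Fin m → ℂ) r)).toReal with hV
    have hV0 : 0 < V := ENNReal.toReal_pos
      (Metric.measure_ball_pos _ _ hr).ne' (measure_ball_lt_top).ne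
    refine ⟨(√V)⁻¹, by positivity, fun w hw k l => ?_⟩
    have h1 := enorm_sq_mul_volume_ball_le ((hg k).sub (hg l)) hw
    have h2 : ∫⁻ z in Ω, ‖(g k - g l) z‖ₑ ^ 2 = ENNReal.ofReal (‖f k - f l‖ ^ 2) := by
      rw [ENNReal.ofReal_pow (norm_nonneg _), ofReal_norm, Lp.enorm_def]
      have h3 := eLpNorm_nnreal_pow_eq_lintegral (p := 2)
        (μ := volume.restrict (Ω : Set (Fin m → ℂ))) (f := ⇑(f k - f l)) two_ne_zero
      simp only [NNReal.coe_ofNat, ENNReal.coe_ofNat, ENNReal.rpow_ofNat] at h3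
      rw [h3]
      refine lintegral_congr_ae ?_
      filter_upwards [Lp.coeFn_sub (f k) (f l), hfg k, hfg l] with z h4 h5 h6
      rw [h4, Pi.sub_apply, Pi.sub_apply, h5, h6]
    rw [h2] at h1
    have h3 : ‖g k w - g l w‖ ^ 2 * V ≤ ‖f k - f l‖ ^ 2 := by
      have := ENNReal.toReal_mono ENNReal.ofReal_ne_top h1
      rw [ENNReal.toReal_ofReal (by positivity), ENNReal.toReal_mul] at this
      simpa using this
    rw [← Real.sqrt_sq (norm_nonneg (f k - f l)), ← div_eq_inv_mul,
      le_div_iff₀ (by positivity), ← Real.sqrt_sq (norm_nonneg (g k w - g l w)),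
      ← Real.sqrt_mul (by positivity)]
    exact Real.sqrt_le_sqrt h3
  have hunif : ∀ r : ℝ, 0 < r → ∀ ε > 0, ∃ N, ∀ k ≥ N, ∀ l ≥ N,
      ∀ w, Metric.ball w r ⊆ (Ω : Set (Fin m → ℂ)) → ‖g k w - g l w‖ < ε := by
    intro r hr ε hε
    obtain ⟨C, hC, hb⟩ := hbound r hr
    obtain ⟨N, hN⟩ := Metric.cauchySeq_iff.1 hcauchy (ε / C) (by positivity)
    refine ⟨N, fun k hk l hl w hw => (hb w hw k l).trans_lt ?_⟩
    have := hN k hk l hl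
    rw [dist_eq_norm, lt_div_iff₀ hC] at this
    linarith
  have hpt : ∀ w, ∃ y, w ∈ (Ω : Set (Fin m → ℂ)) → Tendsto (fun n => g n w) atTop (𝓝 y) := by
    intro w
    by_cases hw : w ∈ (Ω : Set (Fin m → ℂ))
    · obtain ⟨r, hr, hrΩ⟩ := Metric.isOpen_iff.1 Ω.isOpen w hw
      have : CauchySeq fun n => g n w := by
        refine Metric.cauchySeq_iff.2 fun ε hε => ?_
        obtain ⟨N, hN⟩ := hunif r hr ε hε
        exact ⟨N, fun k hk l hl => by rw [dist_eq_norm]; exact hN k hk l hl w hrΩ⟩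
      obtain ⟨y, hy⟩ := cauchySeq_tendsto_of_complete this
      exact ⟨y, fun _ => hy⟩
    · exact ⟨0, fun h => absurd h hw⟩
  choose G hG using hpt
  refine ⟨G, ?_, ?_⟩
  · intro a ha
    obtain ⟨R, hR, hRΩ⟩ := Metric.isOpen_iff.1 Ω.isOpen a ha
    set r := R / 3 with hr
    have hr0 : 0 < r := by positivity
    have hsub : ∀ w ∈ Metric.ball a r, ∀ z ∈ Metric.ball w r,
        Metric.ball z r ⊆ (Ω : Set (Fin m → ℂ)) := by
      intro w hw z hz u hu
      apply hRΩ
      simp only [Metric.mem_ball] at *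
      linarith [dist_triangle u z a, dist_triangle z w a]
    have hz0 : ∀ w ∈ Metric.ball a r, ∀ z ∈ Metric.ball w r, z ∈ (Ω : Set (Fin m → ℂ)) :=
      fun w hw z hz => hsub w hw z hz (Metric.mem_ball_self hr0)
    have hdiff : ∀ n, ∀ w ∈ Metric.ball a r, DifferentiableAt ℂ (g n) w := fun n w hw =>
      (hg n).differentiableAt (Ω.isOpen.mem_nhds (hz0 w hw w (Metric.mem_ball_self hr0)))
    have hu : UniformCauchySeqOn (fun n => fderiv ℂ (g n)) atTop (Metric.ball a r) := by
      refine Metric.uniformCauchySeqOn_iff.2 fun ε hε => ?_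
      obtain ⟨N, hN⟩ := hunif r hr0 (ε * r / 4) (by positivity)
      refine ⟨N, fun k hk l hl w hw => ?_⟩
      have hb : ‖fderiv ℂ (g k - g l) w‖ ≤ (ε * r / 2) / r := by
        refine Complex.norm_fderiv_le_div_of_mapsTo_ball
          (((hg k).sub (hg l)).mono (hz0 w hw)) ?_ hr0
        intro z hz
        have h1 := hN k hk l hl z (hsub w hw z hz)
        have h2 := hN k hk l hl w (hsub w hw w (Metric.mem_ball_self hr0))
        rw [Metric.mem_closedBall, dist_eq_norm]
        refine (norm_sub_le _ _).trans ?_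
        simp only [Pi.sub_apply]
        linarith
      rw [fderiv_sub (hdiff k w hw) (hdiff l w hw)] at hb
      rw [dist_eq_norm]
      have : (ε * r / 2) / r = ε / 2 := by field_simp
      linarith
    have hlim' : ∀ w, ∃ y, w ∈ Metric.ball a r →
        Tendsto (fun n => fderiv ℂ (g n) w) atTop (𝓝 y) := by
      intro w
      by_cases hw : w ∈ Metric.ball a r
      · obtain ⟨y, hy⟩ := cauchySeq_tendsto_of_complete (hu.cauchySeq hw)
        exact ⟨y, fun _ => hy⟩
      · exact ⟨0, fun h => absurd h hw⟩
    choose G' hG' using hlim'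
    have := hasFDerivAt_of_tendstoUniformlyOn Metric.isOpen_ball
      (hu.tendstoUniformlyOn_of_tendsto hG') (fun n w hw => (hdiff n w hw).hasFDerivAt)
      (fun w hw => hG w (hz0 w hw w (Metric.mem_ball_self hr0))) (Metric.mem_ball_self hr0)
    exact this.differentiableAt.differentiableWithinAt
  · obtain ⟨φ, hφ, hae⟩ := (tendstoInMeasure_of_tendsto_Lp hlim).exists_seq_tendsto_ae
    have hall : ∀ᵐ z ∂(volume.restrict (Ω : Set (Fin m → ℂ))), ∀ n, f n z = g n z :=
      ae_all_iff.2 hfg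
    filter_upwards [hae, hall, ae_restrict_mem Ω.isOpen.measurableSet] with z h1 h2 h3
    simp_rw [h2] at h1
    exact tendsto_nhds_unique h1 ((hG z h3).comp hφ.tendsto_atTop)

instance instCompleteSpaceBergmanSpace {m : ℕ} (Ω : TopologicalSpace.Opens (Fin m → ℂ)) : CompleteSpace (bergmanSpace Ω) :=
  (isClosed_bergmanSpace Ω).completeSpace_coe

/-- The coordinate function `z ↦ z j` on a bounded open set is essentially bounded. -/
theorem memLp_top_coord {m : ℕ} (Ω : TopologicalSpace.Opens (Fin m → ℂ))
    (hΩ : Bornology.IsBounded (Ω : Set (Fin m → ℂ))) (j : Fin m) :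
    MemLp (fun z : Fin m → ℂ => z j) ∞ (volume.restrict Ω) := by
  obtain ⟨C, hC⟩ := hΩ.exists_norm_le
  refine memLp_top_of_bound (continuous_apply j).aestronglyMeasurable C ?_
  filter_upwards [ae_restrict_mem Ω.isOpen.measurableSet] with z hz
  exact (norm_le_pi_norm z j).trans (hC z hz)

/-- The multiplication operator `M_{z_j}` on `L²_a(Ω)`, `f ↦ z_j f`, for a bounded open set `Ω`. -/
noncomputable def coordMul {m : ℕ} (Ω : TopologicalSpace.Opens (Fin m → ℂ))
    (hΩ : Bornology.IsBounded (Ω : Set (Fin m → ℂ))) (j : Fin m) :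
    bergmanSpace Ω →L[ℂ] bergmanSpace Ω :=
  LinearMap.mkContinuous
    { toFun := fun f => ⟨(memLp_top_coord Ω hΩ j).toLp • f.1, by
        obtain ⟨g, hg, hfg⟩ := f.2
        refine ⟨fun z => z j * g z, ((differentiable_apply j).differentiableOn).mul hg, ?_⟩
        filter_upwards [Lp.coeFn_lpSMul (r := 2) (memLp_top_coord Ω hΩ j).toLp f.1, hfg,
          (memLp_top_coord Ω hΩ j).coeFn_toLp] with z h1 h2 h3
        simp [h1, h2, h3]⟩
      map_add' := fun f g => Subtype.ext (Lp.add_smul _ _ _)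
      map_smul' := fun c f => Subtype.ext (Lp.smul_comm _ _ _).symm }
    ‖(memLp_top_coord Ω hΩ j).toLp‖ (fun f => Lp.norm_smul_le _ _)

theorem coordMul_ae_eq {m : ℕ} (Ω : TopologicalSpace.Opens (Fin m → ℂ))
    (hΩ : Bornology.IsBounded (Ω : Set (Fin m → ℂ))) (j : Fin m) (f : bergmanSpace Ω) :
    (coordMul Ω hΩ j f).1 =ᵐ[volume.restrict Ω] fun z => z j * f.1 z := by
  filter_upwards [Lp.coeFn_lpSMul (r := 2) (memLp_top_coord Ω hΩ j).toLp f.1,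
    (memLp_top_coord Ω hΩ j).coeFn_toLp] with z h1 h2
  simp [coordMul, h1, h2]

/-- The egg domain `{z ∈ ℂ^m : ∑_j |z_j|^{2 p_j} < 1}`. -/
def eggDomain {m : ℕ} (p : Fin m → ℝ) (hp : ∀ j, 0 < p j) :
    TopologicalSpace.Opens (Fin m → ℂ) where
  carrier := {z | ∑ j, ‖z j‖ ^ (2 * p j) < 1}
  is_open' := by
    refine isOpen_lt (continuous_finsetSum _ fun j _ => ?_) continuous_const
    exact (continuous_apply j).norm.rpow_const fun _ => Or.inr (by have := hp j; positivity)

theorem isBounded_eggDomain {m : ℕ} (p : Fin m → ℝ) (hp : ∀ j, 0 < p j) :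
    Bornology.IsBounded (eggDomain p hp : Set (Fin m → ℂ)) := by
  refine Metric.isBounded_closedBall (x := (0 : Fin m → ℂ)) (r := 1) |>.subset fun z hz => ?_
  rw [mem_closedBall_zero_iff, pi_norm_le_iff_of_nonneg zero_le_one]
  intro j
  by_contra! h
  have h1 : (1 : ℝ) < ‖z j‖ ^ (2 * p j) := Real.one_lt_rpow h (by have := hp j; positivity)
  have h2 : ‖z j‖ ^ (2 * p j) ≤ ∑ i, ‖z i‖ ^ (2 * p i) :=
    Finset.single_le_sum (f := fun i => ‖z i‖ ^ (2 * p i)) (fun i _ => by positivity)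
      (Finset.mem_univ j)
  have h3 : ∑ i, ‖z i‖ ^ (2 * p i) < 1 := hz
  linarith

/-! The egg domain is invariant under rotating each coordinate, so the monomials are orthogonal in
the Bergman space; they are complete because the domain is balanced, so that a holomorphic function
is there the sum of its homogeneous Taylor terms. Integrating `|z^α|² exp(-∑ |z_j|^(2p_j))` over the
whole space in two ways gives `‖z^α‖² = ∏ (π/p_j) Γ(s_j) / Γ(S+1)`, where `s_j = (α_j+1)/p_j` and `S
= ∑ s_j`. Thus each `M_{z_j}` is a weighted shift on `ℕ^m` whose squared weight is a quotient of two
ratios `Γ(x+a)/Γ(x)`, with `a = 1/p_j`, taken at `x = s_j` and at `x = T = S+1`.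

Every commutator sends basis vectors to multiples of basis vectors, and `q`-summability becomes
convergence of the sum of the `q`-th powers of these multiples (`isSchattenSummable_iff`).
Log-convexity of `Γ` controls them. The self-commutator eigenvalue is `O(s_j^(a-1) T^(-a))`
everywhere, and of exactly this order when `T` is much larger than `s_j`, or when `α_j = 0`. Cross
commutators are `O(1/T)`.

For `m > 1` two regions decide the sum. In the bulk, where all coordinates are of size `N`, there
are about `N^m` indices with eigenvalue about `1/N`, which forces `q > m`. On the face `α_j = 0`
there are about `N^(m-1)` indices with eigenvalue about `N^(-a)`, which forces `q > p_j (m-1)`.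
`summable_mul_multiWeight_rpow` shows that the two conditions suffice, and `q > m` already handles
the cross commutators. For `m = 1` one has `T = s + 1`; the leading terms cancel, the eigenvalue is
`1/((n+1)(n+2))` whatever `p` is, and the threshold is `1/2`. -/

section Abstract

/-! ### Schatten summability of operators diagonalised by a Hilbert basis. -/

variable {H : Type u} [NormedAddCommGroup H] [InnerProductSpace ℂ H] [CompleteSpace H]

/-- The continuous functional calculus acts on an eigenvector by evaluation at the eigenvalue. -/
theorem cfcHom_apply_of_apply_eq_smul {A : H →L[ℂ] H} (hA : IsSelfAdjoint A) {e : H} {l : ℝ}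
    (he : A e = l • e) (hl : l ∈ spectrum ℝ A) (f : C(spectrum ℝ A, ℝ)) :
    cfcHom hA f e = f ⟨l, hl⟩ • e := by
  have hid : cfcHom hA (.restrict (spectrum ℝ A) (.id ℝ)) = A := cfcHom_id hA
  -- Stone–Weierstrass: the identity holds on polynomials in `A`, and both sides are continuous in
  -- `f`.
  induction f using ContinuousMap.induction_on_of_compact with
  | const r =>
    have : (ContinuousMap.const (spectrum ℝ A) r) = algebraMap ℝ _ r := rfl
    rw [this, AlgHomClass.commutes]
    simp [Algebra.algebraMap_eq_smul_one]
  | id => rw [hid, he]; rfl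
  | star_id => rw [map_star, hid, hA.star_eq, he]; rfl
  | add f g hf hg => rw [map_add, _root_.add_apply, hf, hg, ← add_smul]; rfl
  | mul f g hf hg =>
    rw [map_mul, mul_apply_eq_comp, hg, ContinuousLinearMap.map_smul_of_tower, hf,
      smul_smul, mul_comm]
    rfl
  | frequently f h =>
    refine h.mem_of_closed (isClosed_eq ?_ ?_)
    · exact ((ContinuousLinearMap.apply ℂ H e).continuous).comp (cfcHom_continuous hA)
    · fun_prop

theorem mem_spectrum_of_apply_eq_smul {A : H →L[ℂ] H} {e : H} {l : ℝ}
    (he : A e = l • e) (h0 : e ≠ 0) : l ∈ spectrum ℝ A := by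
  rw [spectrum.mem_iff]
  intro hu
  obtain ⟨u, hu⟩ := hu
  apply h0
  have h1 : (u : H →L[ℂ] H) e = 0 := by
    rw [hu]
    simp [he, Algebra.algebraMap_eq_smul_one]
  have h2 : ((↑u⁻¹ : H →L[ℂ] H) * u) e = 0 := by
    rw [mul_apply_eq_comp, h1, map_zero]
  simpa using h2

theorem rpow_apply_of_apply_eq_smul {A : H →L[ℂ] H} (hA : 0 ≤ A) {e : H} {l r : ℝ}
    (he : A e = l • e) (hr : 0 ≤ r) : (A ^ r) e = (l ^ r) • e := by
  by_cases h0 : e = 0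
  · simp [h0]
  have hsa : IsSelfAdjoint A := hA.isSelfAdjoint
  have hl := mem_spectrum_of_apply_eq_smul he h0
  have hc : ContinuousOn (fun x : ℝ => x ^ r) (spectrum ℝ A) :=
    (Real.continuous_rpow_const hr).continuousOn
  rw [CFC.rpow_eq_cfc_real hA, cfc_apply (fun x : ℝ => x ^ r) A hsa hc,
    cfcHom_apply_of_apply_eq_smul hsa he hl]
  rfl

theorem HilbertBasis.hasSum_norm_sq_inner {ι : Type*} (e : HilbertBasis ι ℂ H) (x : H) :
    HasSum (fun i => ‖inner ℂ (e i) x‖ ^ 2) (‖x‖ ^ 2) := by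
  have h := e.hasSum_inner_mul_inner x x
  have h2 := (Complex.hasSum_iff _ _).1 h
  convert h2.1 using 1
  · funext i
    rw [← inner_conj_symm x (e i), ← Complex.normSq_eq_conj_mul_self, Complex.ofReal_re,
      Complex.normSq_eq_norm_sq]
  · rw [inner_self_eq_norm_sq_to_K]
    norm_cast

theorem HilbertBasis.tsum_enorm_sq_inner {ι : Type*} (e : HilbertBasis ι ℂ H) (x : H) :
    ∑' i, ENNReal.ofReal (‖inner ℂ (e i) x‖ ^ 2) = ENNReal.ofReal (‖x‖ ^ 2) := by
  have h := e.hasSum_norm_sq_inner x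
  rw [← h.tsum_eq, ENNReal.ofReal_tsum_of_nonneg (fun _ => by positivity) h.summable]

/-- Basis independence of the Hilbert–Schmidt norm: expand each `‖B e_i‖²` in the basis `f` and
exchange the sums, which needs no summability in `ℝ≥0∞`. It removes the existential choice of basis
from `IsTraceClass`, applied with `B` the square root of the operator. -/
theorem summable_norm_sq_apply_of_hilbertBasis {ι κ : Type*} (e : HilbertBasis ι ℂ H)
    (f : HilbertBasis κ ℂ H) {B : H →L[ℂ] H} (hB : IsSelfAdjoint B)
    (h : Summable fun i => ‖B (e i)‖ ^ 2) : Summable fun j => ‖B (f j)‖ ^ 2 := by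
  have key : ∑' i, ENNReal.ofReal (‖B (e i)‖ ^ 2) = ∑' j, ENNReal.ofReal (‖B (f j)‖ ^ 2) := by
    simp_rw [← f.tsum_enorm_sq_inner (B (e _)), ← e.tsum_enorm_sq_inner (B (f _))]
    rw [ENNReal.tsum_comm]
    refine tsum_congr fun j => tsum_congr fun i => ?_
    rw [← ContinuousLinearMap.adjoint_inner_left, ← ContinuousLinearMap.star_eq_adjoint,
      hB.star_eq, norm_inner_symm]
  have h1 : ∑' j, ENNReal.ofReal (‖B (f j)‖ ^ 2) ≠ ∞ := by
    rw [← key, ← ENNReal.ofReal_tsum_of_nonneg (fun _ => by positivity) h]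
    exact ENNReal.ofReal_ne_top
  have h2 := ENNReal.summable_toReal h1
  refine h2.congr fun j => ?_
  rw [ENNReal.toReal_ofReal (by positivity)]

/-- For positive operators, the trace class condition can be checked on any Hilbert basis. -/
theorem isTraceClass_iff_of_nonneg {ι : Type u} (e : HilbertBasis ι ℂ H) {A : H →L[ℂ] H}
    (hA : 0 ≤ A) : IsTraceClass A ↔ Summable fun i => (inner ℂ (e i) (A (e i))).re := by
  have hsq : ∀ x : H, (inner ℂ x (A x)).re = ‖CFC.sqrt A x‖ ^ 2 := by
    intro x
    have hB : IsSelfAdjoint (CFC.sqrt A) := (CFC.sqrt_nonneg A).isSelfAdjoint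
    conv_lhs => rw [← CFC.sqrt_mul_sqrt_self A hA]
    rw [mul_apply_eq_comp, ← ContinuousLinearMap.adjoint_inner_left,
      ← ContinuousLinearMap.star_eq_adjoint, hB.star_eq, inner_self_eq_norm_sq_to_K]
    norm_cast
  unfold IsTraceClass
  rw [CFC.abs_of_nonneg A hA]
  simp_rw [hsq]
  constructor
  · rintro ⟨κ, f, hf⟩
    exact summable_norm_sq_apply_of_hilbertBasis f e (CFC.sqrt_nonneg A).isSelfAdjoint hf
  · intro h
    exact ⟨ι, e, h⟩

/-- If each `e_i` is an eigenvector of `T T^*`, the eigenvalue must be `‖T^* e_i‖²`, so the diagonal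
entry of `(T T^*)^(q/2)` is `‖T^* e_i‖^q`. -/
theorem isSchattenSummable_iff {ι : Type u} (e : HilbertBasis ι ℂ H) {q : ℝ} (hq : 0 < q)
    {T : H →L[ℂ] H}
    (hT : ∀ i, ∃ c : ℂ, T (ContinuousLinearMap.adjoint T (e i)) = c • e i) :
    IsSchattenSummable q T ↔ Summable fun i => ‖ContinuousLinearMap.adjoint T (e i)‖ ^ q := by
  have hA : 0 ≤ T * ContinuousLinearMap.adjoint T := mul_star_self_nonneg T
  unfold IsSchattenSummable
  rw [isTraceClass_iff_of_nonneg e CFC.rpow_nonneg]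
  refine summable_congr fun i => ?_
  obtain ⟨c, hc⟩ := hT i
  have hn : ‖e i‖ = 1 := e.orthonormal.1 i
  have hcc : c = ((‖ContinuousLinearMap.adjoint T (e i)‖ ^ 2 : ℝ) : ℂ) := by
    have h1 : inner ℂ (e i) (T (ContinuousLinearMap.adjoint T (e i))) = c := by
      rw [hc, inner_smul_right, inner_self_eq_norm_sq_to_K, hn]; simp
    rw [← h1, ← ContinuousLinearMap.adjoint_inner_left, inner_self_eq_norm_sq_to_K]
    norm_cast
  have he : (T * ContinuousLinearMap.adjoint T) (e i)
      = (‖ContinuousLinearMap.adjoint T (e i)‖ ^ 2 : ℝ) • e i := by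
    rw [mul_apply_eq_comp, hc, hcc]
    rfl
  rw [rpow_apply_of_apply_eq_smul hA he (by positivity), inner_smul_right_eq_smul, inner_self_eq_norm_sq_to_K, hn, ← Real.rpow_natCast,
    ← Real.rpow_mul (norm_nonneg _)]
  simp
  ring_nf

end Abstract

/-! ### Commutators of commuting-type weighted shifts on `ℕ^m`. -/

section WeightedShifts

-- `IsTraceClass` takes its index type in the universe of the space; the index type `Fin m → ℕ` lies
-- in `Type`.
variable {H : Type} [NormedAddCommGroup H] [InnerProductSpace ℂ H] [CompleteSpace H] {m : ℕ}
  {E : HilbertBasis (Fin m → ℕ) ℂ H} {M : Fin m → H →L[ℂ] H} {w : Fin m → (Fin m → ℕ) → ℝ}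

theorem HilbertBasis.ext_inner_left {ι : Type*} {F : HilbertBasis ι ℂ H} {x y : H}
    (h : ∀ i, inner ℂ (F i) x = inner ℂ (F i) y) : x = y := by
  apply F.repr.injective
  ext i
  rw [F.repr_apply_apply, F.repr_apply_apply, h]

theorem eq_add_single_of_ne_zero {α : Fin m → ℕ} {k : Fin m} (h : α k ≠ 0) :
    ∃ β : Fin m → ℕ, α = β + Pi.single k 1 := by
  refine ⟨α - Pi.single k 1, funext fun i => ?_⟩
  by_cases hi : i = k
  · subst hi; simp; omega
  · simp [hi]

theorem adjoint_shift_apply_add_single (hM : ∀ j α, M j (E α) = (w j α : ℂ) • E (α + Pi.single j 1))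
    (k : Fin m) (β : Fin m → ℕ) :
    ContinuousLinearMap.adjoint (M k) (E (β + Pi.single k 1)) = (w k β : ℂ) • E β := by
  refine HilbertBasis.ext_inner_left (F := E) fun γ => ?_
  rw [ContinuousLinearMap.adjoint_inner_right, hM, inner_smul_left, inner_smul_right,
    orthonormal_iff_ite.1 E.orthonormal, orthonormal_iff_ite.1 E.orthonormal]
  by_cases h : γ = β
  · simp [h]
  · simp [h]

theorem adjoint_shift_apply_eq_zero (hM : ∀ j α, M j (E α) = (w j α : ℂ) • E (α + Pi.single j 1))
    {k : Fin m} {α : Fin m → ℕ} (hα : α k = 0) :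
    ContinuousLinearMap.adjoint (M k) (E α) = 0 := by
  refine HilbertBasis.ext_inner_left (F := E) fun γ => ?_
  rw [ContinuousLinearMap.adjoint_inner_right, hM, inner_smul_left,
    orthonormal_iff_ite.1 E.orthonormal, inner_zero_right, if_neg, mul_zero]
  rintro rfl
  simp at hα

/-- The commutator `[M_j, M_k^*]`. -/
noncomputable def crossCommutator (M : Fin m → H →L[ℂ] H) (j k : Fin m) : H →L[ℂ] H :=
  M j * ContinuousLinearMap.adjoint (M k) - ContinuousLinearMap.adjoint (M k) * M j

theorem adjoint_crossCommutator (j k : Fin m) :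
    ContinuousLinearMap.adjoint (crossCommutator M j k) = crossCommutator M k j := by
  simp only [crossCommutator, ← ContinuousLinearMap.star_eq_adjoint, star_sub, star_mul, star_star]

theorem crossCommutator_apply_add_single
    (hM : ∀ j α, M j (E α) = (w j α : ℂ) • E (α + Pi.single j 1)) (j k : Fin m) (β : Fin m → ℕ) :
    crossCommutator M j k (E (β + Pi.single k 1)) =
      ((w k β * w j β - w j (β + Pi.single k 1) * w k (β + Pi.single j 1) : ℝ) : ℂ) •
        E (β + Pi.single j 1) := by
  rw [crossCommutator, sub_apply, mul_apply_eq_comp, mul_apply_eq_comp,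
    adjoint_shift_apply_add_single hM, hM, map_smul, map_smul, hM, add_right_comm,
    adjoint_shift_apply_add_single hM, smul_smul, smul_smul, ← sub_smul]
  push_cast
  rfl

theorem crossCommutator_apply_of_eq_zero
    (hM : ∀ j α, M j (E α) = (w j α : ℂ) • E (α + Pi.single j 1)) {j k : Fin m} (hjk : j ≠ k)
    {α : Fin m → ℕ} (hα : α k = 0) : crossCommutator M j k (E α) = 0 := by
  rw [crossCommutator, sub_apply, mul_apply_eq_comp, mul_apply_eq_comp,
    adjoint_shift_apply_eq_zero hM hα, hM, map_zero, map_smul,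
    adjoint_shift_apply_eq_zero hM (by simp [hα, hjk.symm]), smul_zero, sub_zero]

theorem crossCommutator_self_apply_of_eq_zero
    (hM : ∀ j α, M j (E α) = (w j α : ℂ) • E (α + Pi.single j 1)) {j : Fin m}
    {α : Fin m → ℕ} (hα : α j = 0) :
    crossCommutator M j j (E α) = ((- w j α ^ 2 : ℝ) : ℂ) • E α := by
  rw [crossCommutator, sub_apply, mul_apply_eq_comp, mul_apply_eq_comp,
    adjoint_shift_apply_eq_zero hM hα, hM, map_zero, map_smul,
    adjoint_shift_apply_add_single hM, smul_smul]
  push_cast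
  rw [neg_smul, zero_sub, pow_two]

/-- The self-commutator is diagonal with eigenvalues `-d α`. The face `α j = 0` is separate because
the adjoint shift kills `E α` there, leaving only one squared weight. -/
theorem isSchattenSummable_crossCommutator_self_iff
    (hM : ∀ j α, M j (E α) = (w j α : ℂ) • E (α + Pi.single j 1)) {q : ℝ} (hq : 0 < q) {j : Fin m}
    {d : (Fin m → ℕ) → ℝ} (hd : ∀ β, d (β + Pi.single j 1) = w j (β + Pi.single j 1) ^ 2 - w j β ^ 2)
    (hd0 : ∀ α : Fin m → ℕ, α j = 0 → d α = w j α ^ 2) :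
    IsSchattenSummable q (crossCommutator M j j) ↔ Summable fun α => |d α| ^ q := by
  have h : ∀ α, crossCommutator M j j (E α) = ((- d α : ℝ) : ℂ) • E α := by
    intro α
    by_cases hα : α j = 0
    · rw [crossCommutator_self_apply_of_eq_zero hM hα, hd0 α hα]
    · obtain ⟨β, rfl⟩ := eq_add_single_of_ne_zero hα
      rw [crossCommutator_apply_add_single hM, hd]
      ring_nf
  rw [isSchattenSummable_iff E hq]
  · refine summable_congr fun α => ?_
    rw [adjoint_crossCommutator, h, norm_smul, E.orthonormal.1, mul_one, Complex.norm_real,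
      Real.norm_eq_abs, abs_neg]
  · intro α
    rw [adjoint_crossCommutator, h, map_smul, h, smul_smul]
    exact ⟨_, rfl⟩

/-- The adjoint `[M_j, M_k^*]` moves `E (β + e_k)` to a multiple of `E (β + e_j)` and kills the face
`α k = 0`. Moving back returns to the same basis vector, so `T T^*` is diagonal and the sum may be
reindexed by `β`. -/
theorem isSchattenSummable_crossCommutator_of_ne
    (hM : ∀ j α, M j (E α) = (w j α : ℂ) • E (α + Pi.single j 1)) {q : ℝ} (hq : 0 < q)
    {j k : Fin m} (hjk : j ≠ k)
    (hs : Summable fun β =>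
      |w k β * w j β - w j (β + Pi.single k 1) * w k (β + Pi.single j 1)| ^ q) :
    IsSchattenSummable q (crossCommutator M k j) := by
  rw [isSchattenSummable_iff E hq]
  · have hinj : Function.Injective fun β : Fin m → ℕ => β + Pi.single k 1 :=
      add_left_injective _
    rw [← hinj.summable_iff]
    · refine hs.congr fun β => ?_
      rw [Function.comp_apply, adjoint_crossCommutator, crossCommutator_apply_add_single hM,
        norm_smul, E.orthonormal.1, mul_one, Complex.norm_real, Real.norm_eq_abs]
    · intro α hα
      have : α k = 0 := by
        by_contra h
        obtain ⟨β, rfl⟩ := eq_add_single_of_ne_zero h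
        exact hα ⟨β, rfl⟩
      rw [adjoint_crossCommutator, crossCommutator_apply_of_eq_zero hM hjk this, norm_zero,
        Real.zero_rpow hq.ne']
  · intro α
    rw [adjoint_crossCommutator]
    by_cases h : α k = 0
    · rw [crossCommutator_apply_of_eq_zero hM hjk h]
      exact ⟨0, by simp⟩
    · obtain ⟨β, rfl⟩ := eq_add_single_of_ne_zero h
      rw [crossCommutator_apply_add_single hM, map_smul, crossCommutator_apply_add_single hM,
        smul_smul]
      exact ⟨_, rfl⟩

end WeightedShifts

/-! ### Asymptotics of Gamma ratios from log-convexity. -/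

section GammaEstimates

/-- The ratio `Γ(x + a) / Γ(x)`. -/
noncomputable def gammaRatio (a x : ℝ) : ℝ := Real.Gamma (x + a) / Real.Gamma x

/-- The cross ratio `Γ(x + a + b) Γ(x) / (Γ(x + a) Γ(x + b))`. -/
noncomputable def gammaCross (a b x : ℝ) : ℝ := gammaRatio a (x + b) / gammaRatio a x

theorem gammaRatio_pos {a x : ℝ} (ha : 0 < a) (hx : 0 < x) : 0 < gammaRatio a x :=
  div_pos (Real.Gamma_pos_of_pos (by positivity)) (Real.Gamma_pos_of_pos hx)

theorem gammaRatio_succ {a x : ℝ} (ha : 0 < a) (hx : 0 < x) :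
    gammaRatio a (x + 1) = gammaRatio a x * ((x + a) / x) := by
  have h1 := Real.Gamma_pos_of_pos hx
  unfold gammaRatio
  rw [add_right_comm, Real.Gamma_add_one (by positivity), Real.Gamma_add_one hx.ne']
  field_simp

/-- By convexity of `log Γ`, its slope on `[x, x+a]` is at most its slope on `[x+a, x+a+1]`, which
is `log (x+a)`. -/
theorem gammaRatio_le {a x : ℝ} (ha : 0 < a) (hx : 0 < x) : gammaRatio a x ≤ (x + a) ^ a := by
  have hxa : 0 < x + a := by positivity
  have h := Real.convexOn_log_Gamma.slope_mono_adjacent (x := x) (y := x + a) (z := x + a + 1) hx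
    (show 0 < x + a + 1 by positivity) (by linarith) (by linarith)
  simp only [Function.comp_apply, Real.Gamma_add_one hxa.ne', add_sub_cancel_left, div_one] at h
  rw [Real.log_mul hxa.ne' (Real.Gamma_pos_of_pos hxa).ne', add_sub_cancel_right,
    ← Real.log_div (Real.Gamma_pos_of_pos hxa).ne' (Real.Gamma_pos_of_pos hx).ne',
    div_le_iff₀ ha] at h
  rw [← Real.log_le_log_iff (gammaRatio_pos ha hx) (by positivity), Real.log_rpow hxa]
  unfold gammaRatio
  linarith

/-- Here the slope `log x` on `[x, x+1]` bounds from below the slope on `[x+1, x+1+a]`; the factor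
`x / (x+a)` comes from shifting the ratio back from `x+1` to `x`. -/
theorem le_gammaRatio {a x : ℝ} (ha : 0 < a) (hx : 0 < x) :
    x ^ a * (x / (x + a)) ≤ gammaRatio a x := by
  have hxa : 0 < x + a := by positivity
  have hx1 : 0 < x + 1 := by positivity
  have hx1a : 0 < x + 1 + a := by positivity
  have h := Real.convexOn_log_Gamma.slope_mono_adjacent (x := x) (y := x + 1) (z := x + 1 + a) hx
    (show 0 < x + 1 + a by positivity) (by linarith) (by linarith)
  simp only [Function.comp_apply, add_sub_cancel_left, div_one] at h
  nth_rw 1 [Real.Gamma_add_one hx.ne'] at h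
  rw [Real.log_mul hx.ne' (Real.Gamma_pos_of_pos hx).ne', add_sub_cancel_right,
    ← Real.log_div (Real.Gamma_pos_of_pos hx1a).ne' (Real.Gamma_pos_of_pos hx1).ne',
    le_div_iff₀ ha] at h
  have h2 : x ^ a ≤ gammaRatio a (x + 1) := by
    rw [← Real.log_le_log_iff (by positivity) (gammaRatio_pos ha hx1), Real.log_rpow hx]
    unfold gammaRatio
    linarith
  rw [gammaRatio_succ ha hx] at h2
  calc x ^ a * (x / (x + a)) ≤ (gammaRatio a x * ((x + a) / x)) * (x / (x + a)) := by gcongr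
    _ = gammaRatio a x := by field_simp

theorem exists_gammaRatio_le {a x₀ : ℝ} (ha : 0 < a) (hx₀ : 0 < x₀) :
    ∃ C, 0 < C ∧ ∀ x, x₀ ≤ x → gammaRatio a x ≤ C * x ^ a := by
  refine ⟨(1 + a / x₀) ^ a, by positivity, fun x hx => ?_⟩
  have hx0 : 0 < x := hx₀.trans_le hx
  refine (gammaRatio_le ha hx0).trans ?_
  rw [← Real.mul_rpow (by positivity) hx0.le]
  refine Real.rpow_le_rpow (by positivity) ?_ ha.le
  have : a ≤ a / x₀ * x := by
    rw [div_mul_eq_mul_div, le_div_iff₀ hx₀]; gcongr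
  linarith

theorem exists_le_gammaRatio {a x₀ : ℝ} (ha : 0 < a) (hx₀ : 0 < x₀) :
    ∃ c, 0 < c ∧ ∀ x, x₀ ≤ x → c * x ^ a ≤ gammaRatio a x := by
  refine ⟨x₀ / (x₀ + a), by positivity, fun x hx => ?_⟩
  have hx0 : 0 < x := hx₀.trans_le hx
  refine le_trans ?_ (le_gammaRatio ha hx0)
  rw [mul_comm]
  gcongr ?_ * ?_
  rw [div_le_div_iff₀ (by positivity) (by positivity)]
  nlinarith

theorem gammaCross_pos {a b x : ℝ} (ha : 0 < a) (hb : 0 < b) (hx : 0 < x) :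
    0 < gammaCross a b x :=
  div_pos (gammaRatio_pos ha (by positivity)) (gammaRatio_pos ha hx)

theorem gammaCross_succ {a b x : ℝ} (ha : 0 < a) (hb : 0 < b) (hx : 0 < x) :
    gammaCross a b x = gammaCross a b (x + 1) * (1 + a * b / (x * (x + a + b))) := by
  have h1 := gammaRatio_pos ha hx
  unfold gammaCross
  rw [add_right_comm, gammaRatio_succ ha hx, gammaRatio_succ ha (by positivity)]
  field_simp
  ring

/-- The quotient `F` of the two sides does not increase under `x ↦ x + 1`, and along `x + n` it has
a lower bound tending to `1`; hence `F x ≥ 1`. -/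
theorem le_gammaCross {a b x : ℝ} (ha : 0 < a) (hb : 0 < b) (hx : 0 < x) :
    1 + a * b / (x + a + b) ≤ gammaCross a b x := by
  open Filter Topology in
  set F : ℝ → ℝ := fun x => gammaCross a b x / (1 + a * b / (x + a + b)) with hF
  have hstep : ∀ x, 0 < x → F (x + 1) ≤ F x := by
    intro x hx
    have h1 := gammaCross_pos ha hb (show 0 < x + 1 by positivity)
    simp only [hF]
    rw [gammaCross_succ ha hb hx, div_le_div_iff₀ (by positivity) (by positivity), mul_assoc]
    gcongr
    -- The comparison function satisfies a recursion of the same shape as `gammaCross_succ`, with a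
    -- larger denominator and hence a smaller factor.
    have h2 : (1 + a * b / (x + a + b)) =
        (1 + a * b / (x + 1 + a + b)) *
          (1 + a * b / ((x + a + b) * (x + a + b + a * b + 1))) := by
      field_simp
      ring
    have h3 : x * (x + a + b) ≤ (x + a + b) * (x + a + b + a * b + 1) := by
      rw [mul_comm]
      gcongr
      linarith [mul_pos ha hb]
    have h4 := div_le_div_of_nonneg_left (mul_pos ha hb).le (by positivity) h3
    rw [h2, mul_comm]
    exact mul_le_mul_of_nonneg_right (by linarith) (by positivity)
  have hmono : ∀ n : ℕ, F (x + n) ≤ F x := by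
    intro n
    induction n with
    | zero => simp
    | succ n ih =>
      refine le_trans ?_ ih
      have := hstep (x + n) (by positivity)
      push_cast
      rwa [← add_assoc]
  have hlow : ∀ y, 0 < y → ((y + b) / (y + a)) ^ a * ((y + b) / (y + b + a)) /
      (1 + a * b / (y + a + b)) ≤ F y := by
    intro y hy
    simp only [hF]
    gcongr
    rw [gammaCross, le_div_iff₀ (gammaRatio_pos ha hy)]
    refine le_trans ?_ (le_gammaRatio ha (show 0 < y + b by positivity))
    calc _ ≤ ((y + b) / (y + a)) ^ a * ((y + b) / (y + b + a)) * (y + a) ^ a := by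
          gcongr; exact gammaRatio_le ha hy
      _ = _ := by
        rw [Real.div_rpow (by positivity) (by positivity)]
        have : 0 < (y + a) ^ a := by positivity
        field_simp
  have hfrac : ∀ c d : ℝ, Tendsto (fun y : ℝ => (y + c) / (y + d)) atTop (𝓝 1) := by
    intro c d
    have h1 : Tendsto (fun y : ℝ => 1 + (c - d) / (y + d)) atTop (𝓝 (1 + 0)) :=
      tendsto_const_nhds.add (tendsto_const_nhds.div_atTop
        (tendsto_atTop_add_const_right _ _ tendsto_id))
    rw [add_zero] at h1
    refine h1.congr' ?_
    filter_upwards [eventually_gt_atTop (-d)] with y hy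
    have : y + d ≠ 0 := by linarith
    field_simp
    ring
  have hlim : Tendsto (fun y : ℝ => ((y + b) / (y + a)) ^ a * ((y + b) / (y + b + a)) /
      (1 + a * b / (y + a + b))) atTop (𝓝 ((1 : ℝ) ^ a * 1 / (1 + 0))) := by
    refine Tendsto.div (Tendsto.mul ((hfrac _ _).rpow_const (Or.inl one_ne_zero)) ?_)
      (tendsto_const_nhds.add (tendsto_const_nhds.div_atTop ?_)) (by norm_num)
    · simp_rw [add_assoc]
      exact hfrac _ _
    · simp_rw [add_assoc]
      exact tendsto_atTop_add_const_right _ _ tendsto_id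
  have hone : 1 ≤ F x := by
    have h2 : Tendsto (fun n : ℕ => x + n) atTop atTop :=
      tendsto_atTop_add_const_left _ _ tendsto_natCast_atTop_atTop
    have h3 := hlim.comp h2
    rw [Real.one_rpow, add_zero, one_mul, div_one] at h3
    exact le_of_tendsto' h3 fun n => (hlow _ (by positivity)).trans (hmono n)
  simp only [hF] at hone
  rwa [le_div_iff₀ (by positivity), one_mul] at hone

theorem one_le_gammaCross {a b x : ℝ} (ha : 0 < a) (hb : 0 < b) (hx : 0 < x) :
    1 ≤ gammaCross a b x :=
  le_trans (by have : 0 ≤ a * b / (x + a + b) := by positivity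
               linarith) (le_gammaCross ha hb hx)

theorem exists_gammaCross_le {a b x₀ : ℝ} (ha : 0 < a) (hb : 0 < b) (hx₀ : 0 < x₀) :
    ∃ C, 0 < C ∧ ∀ x, x₀ ≤ x → gammaCross a b x ≤ 1 + C / x := by
  -- `c / x` is the exponent obtained by bounding both factors of `h1` through `1 + u ≤ exp u`.
  set c := a * (a + b) + a with hc
  have hc0 : 0 < c := by positivity
  refine ⟨c * Real.exp (c / x₀), by positivity, fun x hx => ?_⟩
  have hx0 : 0 < x := hx₀.trans_le hx
  have h1 : gammaCross a b x ≤ (1 + (a + b) / x) ^ a * (1 + a / x) := by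
    rw [gammaCross, div_le_iff₀ (gammaRatio_pos ha hx0)]
    refine (gammaRatio_le ha (by positivity)).trans ?_
    refine le_trans ?_ (mul_le_mul_of_nonneg_left (le_gammaRatio ha hx0) (by positivity))
    have : (x + b + a) ^ a = (1 + (a + b) / x) ^ a * x ^ a := by
      rw [← Real.mul_rpow (by positivity) hx0.le]
      congr 1
      field_simp
      ring
    rw [this]
    apply le_of_eq
    field_simp
  have h2 : (1 + (a + b) / x) ^ a * (1 + a / x) ≤ Real.exp (c / x) := by
    have e1 : 1 + (a + b) / x ≤ Real.exp ((a + b) / x) := by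
      linarith [Real.add_one_le_exp ((a + b) / x)]
    have e2 : 1 + a / x ≤ Real.exp (a / x) := by
      linarith [Real.add_one_le_exp (a / x)]
    calc _ ≤ Real.exp ((a + b) / x) ^ a * Real.exp (a / x) := by gcongr
      _ = Real.exp (c / x) := by
        rw [← Real.exp_mul, ← Real.exp_add, hc]
        congr 1
        field_simp
  have h3 : Real.exp (c / x) ≤ 1 + c / x * Real.exp (c / x) := by
    have := Real.add_one_le_exp (-(c / x))
    have h4 : Real.exp (c / x) * Real.exp (-(c / x)) = 1 := by
      rw [← Real.exp_add]; simp
    nlinarith [Real.exp_pos (c / x)]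
  have h4 : Real.exp (c / x) ≤ Real.exp (c / x₀) := by gcongr
  calc _ ≤ 1 + c / x * Real.exp (c / x) := h1.trans (h2.trans h3)
    _ ≤ 1 + c / x * Real.exp (c / x₀) := by gcongr
    _ = _ := by ring

/-- This factorisation isolates the cancellation in a difference of squared weights: the two cross
ratios are both close to `1`. -/
theorem gammaRatio_div_sub {a s t : ℝ} (ha : 0 < a) (hs : 0 < s) (ht : 0 < t) :
    gammaRatio a (s + a) / gammaRatio a (t + a) - gammaRatio a s / gammaRatio a t =
      gammaRatio a s / gammaRatio a (t + a) * (gammaCross a a s - gammaCross a a t) := by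
  have h1 := gammaRatio_pos ha hs
  have h2 := gammaRatio_pos ha ht
  have h3 := gammaRatio_pos ha (show 0 < t + a by positivity)
  unfold gammaCross
  field_simp

/-- Both cross ratios lie in `[1, 1 + C₃/s]` since `s ≤ t`, which gains a factor `1/s` over the
prefactor of order `s^a t^(-a)`. -/
theorem exists_abs_gammaRatio_div_sub_le {a : ℝ} (ha : 0 < a) :
    ∃ C, 0 < C ∧ ∀ s t, a ≤ s → 1 ≤ t → s ≤ t →
      |gammaRatio a (s + a) / gammaRatio a (t + a) - gammaRatio a s / gammaRatio a t| ≤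
        C * (s ^ (a - 1) * t ^ (-a)) := by
  obtain ⟨C₁, hC₁, h₁⟩ := exists_gammaRatio_le ha ha
  obtain ⟨c₂, hc₂, h₂⟩ := exists_le_gammaRatio (x₀ := 1) ha one_pos
  obtain ⟨C₃, hC₃, h₃⟩ := exists_gammaCross_le ha ha ha
  refine ⟨C₁ / c₂ * C₃, by positivity, fun s t hs ht hst => ?_⟩
  have hs0 : 0 < s := ha.trans_le hs
  have ht0 : 0 < t := by linarith
  have hts : C₃ / t ≤ C₃ / s := by gcongr
  have hP := gammaRatio_pos ha hs0
  have hQ := gammaRatio_pos ha (show 0 < t + a by positivity)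
  have hX : |gammaCross a a s - gammaCross a a t| ≤ C₃ / s := by
    have e1 := h₃ s hs
    have e2 := h₃ t (hs.trans hst)
    have e3 := one_le_gammaCross ha ha hs0
    have e4 := one_le_gammaCross ha ha ht0
    rw [abs_le]
    constructor <;> linarith
  have hQ' : c₂ * t ^ a ≤ gammaRatio a (t + a) :=
    le_trans (by gcongr; linarith) (h₂ (t + a) (by linarith))
  rw [gammaRatio_div_sub ha hs0 ht0, abs_mul, abs_of_pos (div_pos hP hQ)]
  calc _ ≤ C₁ * s ^ a / (c₂ * t ^ a) * (C₃ / s) := by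
        gcongr
        exact h₁ s hs
    _ = _ := by
      rw [Real.rpow_sub_one hs0.ne', Real.rpow_neg ht0.le]
      field_simp

/-- For `s ≥ a` the cross ratio at `s` exceeds `1` by at least `a²/(3s)`, while at `t` it does so by
at most `C₃/t`, which is below half of that once `t ≥ (6 C₃/a²) s`. Some separation of `s` and `t`
is needed: for `t = s + 1` the difference is of smaller order. -/
theorem exists_le_gammaRatio_div_sub {a : ℝ} (ha : 0 < a) :
    ∃ c K, 0 < c ∧ 1 ≤ K ∧ ∀ s t, a ≤ s → 1 ≤ t → K * s ≤ t →
      c * (s ^ (a - 1) * t ^ (-a)) ≤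
        gammaRatio a (s + a) / gammaRatio a (t + a) - gammaRatio a s / gammaRatio a t := by
  obtain ⟨c₁, hc₁, h₁⟩ := exists_le_gammaRatio ha ha
  obtain ⟨C₂, hC₂, h₂⟩ := exists_gammaRatio_le (x₀ := 1) ha one_pos
  obtain ⟨C₃, hC₃, h₃⟩ := exists_gammaCross_le ha ha ha
  refine ⟨c₁ / (C₂ * (1 + a) ^ a) * (a ^ 2 / 6), max 1 (6 * C₃ / a ^ 2), by positivity,
    le_max_left _ _, fun s t hs ht hst => ?_⟩
  have hs0 : 0 < s := ha.trans_le hs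
  have ht0 : 0 < t := by linarith
  have hst1 : s ≤ t := le_trans (by nlinarith [le_max_left 1 (6 * C₃ / a ^ 2)]) hst
  have hst2 : 6 * C₃ / a ^ 2 * s ≤ t := le_trans (by gcongr; exact le_max_right _ _) hst
  have hX : a ^ 2 / 6 / s ≤ gammaCross a a s - gammaCross a a t := by
    have e1 := le_gammaCross ha ha hs0
    have e2 := h₃ t (hs.trans hst1)
    have e3 : C₃ / t ≤ a ^ 2 / 6 / s := by
      rw [div_le_div_iff₀ ht0 hs0]
      have : 6 * C₃ / a ^ 2 * s * a ^ 2 ≤ t * a ^ 2 := by gcongr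
      field_simp at this ⊢
      linarith
    have e4 : a ^ 2 / 3 / s ≤ a * a / (s + a + a) := by
      rw [div_div, ← pow_two]
      gcongr
      linarith
    have e5 : a ^ 2 / 3 / s = a ^ 2 / 6 / s + a ^ 2 / 6 / s := by ring
    linarith
  have hQ := gammaRatio_pos ha (show 0 < t + a by positivity)
  have hQ' : gammaRatio a (t + a) ≤ C₂ * (1 + a) ^ a * t ^ a := by
    refine (h₂ (t + a) (by linarith)).trans ?_
    rw [mul_assoc, ← Real.mul_rpow (by positivity) (by positivity)]
    gcongr
    nlinarith
  rw [gammaRatio_div_sub ha hs0 ht0]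
  calc _ = c₁ * s ^ a / (C₂ * (1 + a) ^ a * t ^ a) * (a ^ 2 / 6 / s) := by
        rw [Real.rpow_sub_one hs0.ne', Real.rpow_neg ht0.le]
        field_simp
    _ ≤ _ := by
      have hP := gammaRatio_pos ha hs0
      gcongr
      exact h₁ s hs

end GammaEstimates

/-! ### Convergence and divergence of sums over multi-indices. -/

section LatticeSums

variable {m : ℕ}

theorem summable_prod_pi {f : Fin m → ℕ → ℝ} (hf : ∀ i n, 0 ≤ f i n) (hs : ∀ i, Summable (f i)) :
    Summable fun α : Fin m → ℕ => ∏ i, f i (α i) := by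
  refine summable_of_sum_le (c := ∏ i, ∑' n, f i n)
    (fun α => Finset.prod_nonneg fun i _ => hf i _) fun u => ?_
  set v : Fin m → Finset ℕ := fun i => u.image (fun α => α i)
  calc ∑ α ∈ u, ∏ i, f i (α i) ≤ ∑ α ∈ Fintype.piFinset v, ∏ i, f i (α i) := by
        refine Finset.sum_le_sum_of_subset_of_nonneg ?_
          fun α _ _ => Finset.prod_nonneg fun i _ => hf i _
        intro α hα
        rw [Fintype.mem_piFinset]
        exact fun i => Finset.mem_image_of_mem _ hα
    _ = ∏ i, ∑ n ∈ v i, f i n := by rw [Finset.prod_univ_sum]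
    _ ≤ _ := Finset.prod_le_prod (fun i _ => Finset.sum_nonneg fun n _ => hf i n)
        fun i _ => (hs i).sum_le_tsum _ fun n _ => hf i n

theorem summable_prod_rpow {x : Fin m → ℝ} (hx : ∀ i, 1 < x i) :
    Summable fun α : Fin m → ℕ => ∏ i, ((α i : ℝ) + 1) ^ (-x i) := by
  refine summable_prod_pi (f := fun i n => ((n : ℝ) + 1) ^ (-x i)) (fun i n => by positivity)
    fun i => ?_
  have := (summable_nat_add_iff 1).2 (Real.summable_nat_rpow.2 (show -x i < -1 by linarith [hx i]))
  simpa using this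

/-- The weight `1 + |α|` of a multi-index. -/
noncomputable def multiWeight (α : Fin m → ℕ) : ℝ := 1 + ∑ i, (α i : ℝ)

theorem multiWeight_pos (α : Fin m → ℕ) : 0 < multiWeight α := by
  unfold multiWeight; positivity

theorem succ_le_multiWeight (α : Fin m → ℕ) (i : Fin m) : (α i : ℝ) + 1 ≤ multiWeight α := by
  have := Finset.single_le_sum (f := fun i => (α i : ℝ)) (fun i _ => by positivity)
    (Finset.mem_univ i)
  unfold multiWeight
  linarith

/-- The weight dominates every `α i + 1`, so a negative power of it can be shared out among the
coordinates of `s`, reducing lattice sums to products of one-variable series. -/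
theorem multiWeight_rpow_neg_le_prod (α : Fin m → ℕ) {s : Finset (Fin m)} {y : ℝ} (hy : 0 ≤ y) :
    multiWeight α ^ (-((s.card : ℝ) * y)) ≤ ∏ i ∈ s, ((α i : ℝ) + 1) ^ (-y) := by
  rw [← mul_neg, mul_comm, Real.rpow_mul_natCast (multiWeight_pos α).le, ← Finset.prod_const]
  refine Finset.prod_le_prod (fun i _ => Real.rpow_nonneg (multiWeight_pos α).le _) fun i _ => ?_
  exact Real.rpow_le_rpow_of_nonpos (by positivity) (succ_le_multiWeight α i) (by linarith)

theorem summable_multiWeight_rpow (hm : 0 < m) {q : ℝ} (hq : (m : ℝ) < q) :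
    Summable fun α : Fin m → ℕ => multiWeight α ^ (-q) := by
  have hm' : (0 : ℝ) < m := by exact_mod_cast hm
  refine Summable.of_nonneg_of_le (fun α => Real.rpow_nonneg (multiWeight_pos α).le _) (fun α => ?_)
    (summable_prod_rpow (x := fun _ : Fin m => q / m) fun _ => by rwa [lt_div_iff₀ hm', one_mul])
  have := multiWeight_rpow_neg_le_prod α (s := Finset.univ) (y := q / m) (by
    have := hm'.trans hq; positivity)
  rw [Finset.card_univ, Fintype.card_fin, mul_div_cancel₀ _ hm'.ne'] at this
  exact this

/-- Split `a q = δ + (m-1) y`: the part `δ` goes to coordinate `j`, whose exponent becomes `(1-a) q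
+ δ`, and each other coordinate receives `y`. All exponents must exceed `1`. -/
theorem summable_mul_multiWeight_rpow (j : Fin m) {a q : ℝ} (hq : (m : ℝ) < q)
    (ha : (m : ℝ) - 1 < a * q) :
    Summable fun α : Fin m → ℕ =>
      ((α j : ℝ) + 1) ^ ((a - 1) * q) * multiWeight α ^ (-(a * q)) := by
  have hm : 0 < m := j.pos
  have hm' : (1 : ℝ) ≤ m := by exact_mod_cast hm
  have hq0 : 0 < q := by linarith
  -- The two lower bounds for `δ` lie below the upper one exactly by `ha` and `hq` respectively. The
  -- upper bound makes `y > 1`.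
  obtain ⟨δ, hδ1, hδ2⟩ : ∃ δ, max 0 (1 - (1 - a) * q) < δ ∧ δ < a * q - (m - 1) := by
    refine exists_between (max_lt (by linarith) (by linarith))
  rw [max_lt_iff] at hδ1
  by_cases hm1 : m = 1
  · refine Summable.of_nonneg_of_le (fun α => ?_) (fun α => ?_)
      (summable_multiWeight_rpow hm hq)
    · exact mul_nonneg (by positivity) (Real.rpow_nonneg (multiWeight_pos α).le _)
    · have : multiWeight α = α j + 1 := by
        subst hm1
        rw [multiWeight, Finset.univ_unique, Finset.sum_singleton, add_comm,
          Subsingleton.elim default j]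
      rw [this, ← Real.rpow_add (by positivity)]
      apply le_of_eq
      ring_nf
  have hm2 : (0 : ℝ) < m - 1 := by
    have : (2 : ℝ) ≤ m := by exact_mod_cast (by omega : 2 ≤ m)
    linarith
  set y := (a * q - δ) / (m - 1) with hy
  have hy1 : 1 < y := by
    rw [hy, lt_div_iff₀ hm2]; linarith
  refine Summable.of_nonneg_of_le (fun α => ?_) (fun α => ?_)
    (summable_prod_rpow (x := fun i => if i = j then (1 - a) * q + δ else y) fun i => ?_)
  · exact mul_nonneg (by positivity) (Real.rpow_nonneg (multiWeight_pos α).le _)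
  · have hW := multiWeight_pos α
    have h1 : multiWeight α ^ (-(a * q)) =
        multiWeight α ^ (-δ) * multiWeight α ^ (-(((Finset.univ.erase j).card : ℝ) * y)) := by
      rw [← Real.rpow_add hW, Finset.card_erase_of_mem (Finset.mem_univ j), Finset.card_univ,
        Fintype.card_fin, Nat.cast_sub hm, Nat.cast_one, hy, mul_div_cancel₀ _ hm2.ne']
      ring_nf
    have h2 : multiWeight α ^ (-δ) ≤ ((α j : ℝ) + 1) ^ (-δ) :=
      Real.rpow_le_rpow_of_nonpos (by positivity) (succ_le_multiWeight α j) (by linarith)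
    rw [h1, ← Finset.mul_prod_erase _ _ (Finset.mem_univ j), if_pos rfl, ← mul_assoc]
    refine mul_le_mul ?_ ?_ (Real.rpow_nonneg hW.le _) (by positivity)
    · calc _ ≤ ((α j : ℝ) + 1) ^ ((a - 1) * q) * ((α j : ℝ) + 1) ^ (-δ) := by gcongr
        _ = _ := by rw [← Real.rpow_add (by positivity)]; ring_nf
    · refine (multiWeight_rpow_neg_le_prod α (by linarith)).trans (le_of_eq ?_)
      refine Finset.prod_congr rfl fun i hi => ?_
      rw [if_neg (Finset.ne_of_mem_erase hi)]
  · split_ifs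
    · linarith
    · exact hy1

/-- A divergence criterion: the sums over a sequence of blocks escaping to infinity do not
vanish. -/
theorem not_summable_of_blocks {f : (Fin m → ℕ) → ℝ} {B : ℕ → Finset (Fin m → ℕ)} {c : ℝ}
    (hc : 0 < c) (i : Fin m) (hB : ∀ N, ∀ α ∈ B N, N ≤ α i)
    (hsum : ∀ N, 1 ≤ N → c ≤ ∑ α ∈ B N, f α) : ¬ Summable f := by
  intro hf
  obtain ⟨s, hs⟩ := hf.vanishing (Metric.ball_mem_nhds 0 hc)
  -- Beyond the `i`-th coordinates of the exceptional finite set, a block is disjoint from it; the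
  -- `+ 1` also ensures `1 ≤ N`.
  set N := s.sup (fun α => α i) + 1 with hN
  have hd : Disjoint (B N) s := by
    rw [Finset.disjoint_left]
    intro α h1 h2
    have h3 := hB N α h1
    have h4 : α i ≤ s.sup fun α => α i := Finset.le_sup (f := fun α : Fin m → ℕ => α i) h2
    omega
  have h5 := hs _ hd
  rw [mem_ball_zero_iff, Real.norm_eq_abs] at h5
  linarith [hsum N (by omega), le_abs_self (∑ α ∈ B N, f α)]

/-- Divergence from a lower bound on boxes. -/
theorem not_summable_of_le_on_box {f : (Fin m → ℕ) → ℝ} {j : Fin m} {L : ℕ} {c x : ℝ}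
    (hc : 0 < c) (hx : x ≤ m)
    (h : ∀ N : ℕ, 1 ≤ N → ∀ α : Fin m → ℕ, N ≤ α j → α j < 2 * N →
      (∀ i, i ≠ j → L * N ≤ α i ∧ α i < L * N + N) → c * (N : ℝ) ^ (-x) ≤ f α) :
    ¬ Summable f := by
  classical
  refine not_summable_of_blocks (B := fun N => Fintype.piFinset fun i =>
    if i = j then Finset.Ico N (2 * N) else Finset.Ico (L * N) (L * N + N)) hc j ?_ ?_
  · intro N α hα
    rw [Fintype.mem_piFinset] at hα
    have := hα j
    rw [if_pos rfl, Finset.mem_Ico] at this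
    exact this.1
  · intro N hN
    have hN' : (1 : ℝ) ≤ N := by exact_mod_cast hN
    have hcard : (Fintype.piFinset fun i : Fin m =>
        if i = j then Finset.Ico N (2 * N) else Finset.Ico (L * N) (L * N + N)).card = N ^ m := by
      rw [Fintype.card_piFinset]
      have : ∀ i : Fin m, (if i = j then Finset.Ico N (2 * N) else
          Finset.Ico (L * N) (L * N + N)).card = N := by
        intro i
        split_ifs
        · rw [Nat.card_Ico]; omega
        · rw [Nat.card_Ico]; omega
      simp [this]
    -- The box has `N^m` points, each contributing at least `c N^(-x)` with `x ≤ m`.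
    calc c ≤ (N : ℝ) ^ m * (c * (N : ℝ) ^ (-x)) := by
          rw [mul_left_comm, ← Real.rpow_natCast, ← Real.rpow_add (by linarith)]
          exact le_mul_of_one_le_right hc.le (Real.one_le_rpow hN' (by linarith))
      _ ≤ _ := by
        rw [← Nat.cast_pow, ← hcard, ← nsmul_eq_mul]
        refine Finset.card_nsmul_le_sum _ _ _ fun α hα => ?_
        rw [Fintype.mem_piFinset] at hα
        have hj := hα j
        rw [if_pos rfl, Finset.mem_Ico] at hj
        refine h N hN α hj.1 hj.2 fun i hi => ?_
        have := hα i
        rwa [if_neg hi, Finset.mem_Ico] at this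

/-- Divergence from a lower bound on boxes inside the coordinate hyperplane `α j = 0`. -/
theorem not_summable_of_le_on_face {f : (Fin m → ℕ) → ℝ} {j : Fin m} (hm : 2 ≤ m) {c x : ℝ}
    (hc : 0 < c) (hx : x ≤ m - 1)
    (h : ∀ N : ℕ, 1 ≤ N → ∀ α : Fin m → ℕ, α j = 0 →
      (∀ i, i ≠ j → N ≤ α i ∧ α i < 2 * N) → c * (N : ℝ) ^ (-x) ≤ f α) :
    ¬ Summable f := by
  classical
  obtain ⟨i₀, hi₀⟩ : ∃ i : Fin m, i ≠ j := by
    have : Nontrivial (Fin m) := Fin.nontrivial_iff_two_le.2 hm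
    exact exists_ne j
  refine not_summable_of_blocks (B := fun N => Fintype.piFinset fun i =>
    if i = j then {0} else Finset.Ico N (2 * N)) hc i₀ ?_ ?_
  · intro N α hα
    rw [Fintype.mem_piFinset] at hα
    have := hα i₀
    rw [if_neg hi₀, Finset.mem_Ico] at this
    exact this.1
  · intro N hN
    have hN' : (1 : ℝ) ≤ N := by exact_mod_cast hN
    have hcard : (Fintype.piFinset fun i : Fin m =>
        if i = j then {0} else Finset.Ico N (2 * N)).card = N ^ (m - 1) := by
      rw [Fintype.card_piFinset, ← Finset.mul_prod_erase _ _ (Finset.mem_univ j), if_pos rfl,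
        Finset.card_singleton, one_mul]
      have : ∀ i ∈ Finset.univ.erase j, (if i = j then {0} else Finset.Ico N (2 * N)).card = N := by
        intro i hi
        rw [if_neg (Finset.ne_of_mem_erase hi)]
        simp
        omega
      rw [Finset.prod_congr rfl this, Finset.prod_const, Finset.card_erase_of_mem
        (Finset.mem_univ j), Finset.card_univ, Fintype.card_fin]
    calc c ≤ (N : ℝ) ^ (m - 1) * (c * (N : ℝ) ^ (-x)) := by
          rw [mul_left_comm, ← Real.rpow_natCast, ← Real.rpow_add (by linarith),
            Nat.cast_sub (by omega), Nat.cast_one]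
          exact le_mul_of_one_le_right hc.le (Real.one_le_rpow hN' (by linarith))
      _ ≤ _ := by
        rw [← Nat.cast_pow, ← hcard, ← nsmul_eq_mul]
        refine Finset.card_nsmul_le_sum _ _ _ fun α hα => ?_
        rw [Fintype.mem_piFinset] at hα
        have hj := hα j
        rw [if_pos rfl, Finset.mem_singleton] at hj
        refine h N hN α hj fun i hi => ?_
        have := hα i
        rwa [if_neg hi, Finset.mem_Ico] at this

end LatticeSums

/-! ### Smoothness of holomorphic functions of several variables. -/

section SeveralComplexVariables

variable {m : ℕ} {g : (Fin m → ℂ) → ℂ} {U : Set (Fin m → ℂ)}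

/-- A directional derivative of a holomorphic function of several variables is holomorphic. -/
theorem DifferentiableOn.fderiv_apply_const (hg : DifferentiableOn ℂ g U) (hU : IsOpen U)
    (v : Fin m → ℂ) : DifferentiableOn ℂ (fun z => fderiv ℂ g z v) U := by
  open Metric Filter Topology in
  intro z₀ hz₀
  obtain ⟨R, hR, hRU, hRB⟩ : ∃ R, 0 < R ∧ ball z₀ R ⊆ U ∧ ∀ z ∈ ball z₀ R, ‖g z - g z₀‖ < 1 := by
    have hc := (hg.continuousOn.continuousAt (hU.mem_nhds hz₀))
    have h1 : ∀ᶠ z in 𝓝 z₀, z ∈ U ∧ ‖g z - g z₀‖ < 1 := by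
      refine (hU.eventually_mem hz₀).and ?_
      have := hc.eventually (ball_mem_nhds (g z₀) one_pos)
      filter_upwards [this] with z hz
      rwa [dist_eq_norm] at hz
    obtain ⟨R, hR, h⟩ := Metric.eventually_nhds_iff_ball.1 h1
    exact ⟨R, hR, fun z hz => (h z hz).1, fun z hz => (h z hz).2⟩
  -- With this radius the disc `z + w • v` stays in the half ball for every `z` in the quarter ball;
  -- the `+ 1` covers `v = 0`.
  set ρ := R / (4 * (‖v‖ + 1)) with hρ
  have hρ0 : 0 < ρ := by positivity
  have hρv : ρ * ‖v‖ ≤ R / 4 := by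
    rw [hρ, div_mul_eq_mul_div, div_le_div_iff₀ (by positivity) (by positivity)]
    nlinarith [norm_nonneg v]
  have hmem : ∀ z ∈ ball z₀ (R / 4), ∀ w : ℂ, ‖w‖ ≤ ρ → z + w • v ∈ ball z₀ (R / 2) := by
    intro z hz w hw
    rw [mem_ball, dist_eq_norm] at hz ⊢
    calc ‖z + w • v - z₀‖ = ‖(z - z₀) + w • v‖ := by congr 1; abel
      _ ≤ ‖z - z₀‖ + ‖w‖ * ‖v‖ := (norm_add_le _ _).trans (by rw [norm_smul])
      _ < R / 4 + R / 4 := by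
        have : ‖w‖ * ‖v‖ ≤ ρ * ‖v‖ := by gcongr
        linarith
      _ = R / 2 := by ring
  have hsub : ball z₀ (R / 2) ⊆ U := (ball_subset_ball (by linarith)).trans hRU
  have hdiff : ∀ y ∈ U, DifferentiableAt ℂ g y := fun y hy =>
    hg.differentiableAt (hU.mem_nhds hy)
  -- Cauchy's estimate on balls of radius `R/2`, where `g` varies by less than `2`; this dominates
  -- the derivative of the integrand below.
  have hbound : ∀ y ∈ ball z₀ (R / 2), ‖fderiv ℂ g y‖ ≤ 2 / (R / 2) := by
    intro y hy
    have hy' : ball y (R / 2) ⊆ ball z₀ R := by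
      intro u hu
      rw [mem_ball] at *
      linarith [dist_triangle u y z₀]
    refine Complex.norm_fderiv_le_div_of_mapsTo_ball (hg.mono (hy'.trans hRU)) ?_ (by positivity)
    intro u hu
    rw [mem_closedBall, dist_eq_norm]
    have h1 := hRB u (hy' hu)
    have h2 := hRB y (hy' (mem_ball_self (by positivity)))
    calc ‖g u - g y‖ = ‖(g u - g z₀) - (g y - g z₀)‖ := by congr 1; abel
      _ ≤ _ := (norm_sub_le _ _).trans (by linarith)
  set k : ℝ → ℂ := fun θ => _root_.deriv (circleMap 0 ρ) θ * ((circleMap 0 ρ θ - 0) ^ 2)⁻¹ with hk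
  have hcm0 : ∀ θ, circleMap 0 ρ θ ≠ 0 := fun θ => circleMap_ne_center hρ0.ne'
  have hkc : Continuous k := by
    have h1 := continuous_circleMap 0 ρ
    have h2 : Continuous (_root_.deriv (circleMap 0 ρ)) := by
      have : _root_.deriv (circleMap 0 ρ) = fun θ => circleMap 0 ρ θ * Complex.I :=
        funext fun θ => deriv_circleMap 0 ρ θ
      rw [this]
      fun_prop
    refine h2.mul (Continuous.inv₀ (by fun_prop) fun θ => ?_)
    simpa using hcm0 θ
  have hcircle : ∀ θ, ‖circleMap 0 ρ θ‖ ≤ ρ := fun θ => by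
    rw [norm_circleMap_zero, abs_of_pos hρ0]
  have hball : ball z₀ (R / 4) ∈ 𝓝 z₀ := ball_mem_nhds _ (by positivity)
  have hline : ∀ z, Continuous fun θ => z + circleMap 0 ρ θ • v := fun z => by
    have := continuous_circleMap 0 ρ
    fun_prop
  have hcont : ∀ z ∈ ball z₀ (R / 4), Continuous fun θ => k θ * g (z + circleMap 0 ρ θ • v) := by
    intro z hz
    refine hkc.mul (hg.continuousOn.comp_continuous (hline z) fun θ => ?_)
    exact hsub (hmem z hz _ (hcircle θ))
  have hint : HasFDerivAt (fun z => ∫ θ in (0 : ℝ)..2 * Real.pi, k θ * g (z + circleMap 0 ρ θ • v))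
      (∫ θ in (0 : ℝ)..2 * Real.pi, k θ • fderiv ℂ g (z₀ + circleMap 0 ρ θ • v)) z₀ := by
    refine intervalIntegral.hasFDerivAt_integral_of_dominated_of_fderiv_le (𝕜 := ℂ)
      (bound := fun θ => ‖k θ‖ * (2 / (R / 2)))
      (F' := fun z θ => k θ • fderiv ℂ g (z + circleMap 0 ρ θ • v)) hball ?_ ?_ ?_ ?_ ?_ ?_
    · filter_upwards [hball] with z hz
      exact (hcont z hz).aestronglyMeasurable
    · exact (hcont z₀ (mem_of_mem_nhds hball)).intervalIntegrable _ _
    · refine AEStronglyMeasurable.smul hkc.aestronglyMeasurable ?_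
      exact ((measurable_fderiv ℂ g).comp (hline z₀).measurable).aestronglyMeasurable
    · refine Eventually.of_forall fun θ _ z hz => ?_
      rw [norm_smul]
      gcongr
      exact hbound _ (hmem z hz _ (hcircle θ))
    · exact (Continuous.mul (by fun_prop) continuous_const).intervalIntegrable _ _
    · refine Eventually.of_forall fun θ _ z hz => ?_
      have h1 := (hdiff _ (hsub (hmem z hz _ (hcircle θ)))).hasFDerivAt
      have h2 : HasFDerivAt (fun z => g (z + circleMap 0 ρ θ • v))
          (fderiv ℂ g (z + circleMap 0 ρ θ • v)) z :=
        (hasFDerivAt_comp_add_right _).2 h1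
      exact h2.const_smul (k θ)
  -- Cauchy's formula on the complex line through `z` in direction `v` writes the directional
  -- derivative as an integral of `g`, which can be differentiated under the integral sign.
  have heq : (fun z => fderiv ℂ g z v) =ᶠ[𝓝 z₀] fun z => (2 * Real.pi * Complex.I)⁻¹ *
      ∫ θ in (0 : ℝ)..2 * Real.pi, k θ * g (z + circleMap 0 ρ θ • v) := by
    filter_upwards [hball] with z hz
    set V : Set ℂ := (fun w : ℂ => z + w • v) ⁻¹' U with hV
    have hVo : IsOpen V := hU.preimage (by fun_prop)
    have hsubV : closedBall (0 : ℂ) ρ ⊆ V := by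
      intro w hw
      exact hsub (hmem z hz w (by simpa using hw))
    have hdV : DifferentiableOn ℂ (fun w : ℂ => g (z + w • v)) V :=
      hg.comp (by fun_prop) fun w hw => hw
    have hC := Complex.two_pi_I_inv_smul_circleIntegral_sub_sq_inv_smul_of_differentiable hVo
      hsubV hdV (mem_ball_self hρ0)
    have hd : _root_.deriv (fun w : ℂ => g (z + w • v)) 0 = fderiv ℂ g z v := by
      have h1 : HasFDerivAt g (fderiv ℂ g z) (z + (0 : ℂ) • v) := by
        rw [zero_smul, add_zero]
        exact (hdiff z (hRU (ball_subset_ball (by linarith) hz))).hasFDerivAt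
      have h2 : HasDerivAt (fun w : ℂ => z + w • v) v 0 := by
        have := ((hasDerivAt_id (0 : ℂ)).smul_const v).const_add z
        simpa using this
      exact (h1.comp_hasDerivAt 0 h2).deriv
    rw [← hd, ← hC, circleIntegral, smul_eq_mul]
    congr 1
    refine intervalIntegral.integral_congr fun θ _ => ?_
    simp only [hk, smul_eq_mul, mul_assoc]
  exact ((hint.differentiableAt.const_mul _).congr_of_eventuallyEq heq).differentiableWithinAt

theorem DifferentiableOn.contDiffOn_pi (hg : DifferentiableOn ℂ g U) (hU : IsOpen U) (n : ℕ) :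
    ContDiffOn ℂ n g U := by
  induction n generalizing g with
  | zero => exact contDiffOn_zero.2 hg.continuousOn
  | succ n ih =>
    push_cast
    rw [contDiffOn_succ_iff_fderiv_of_isOpen hU]
    refine ⟨hg, by simp, ?_⟩
    have h : fderiv ℂ g = fun z => ∑ j, (fderiv ℂ g z (Pi.single j 1)) •
        (ContinuousLinearMap.proj j : (Fin m → ℂ) →L[ℂ] ℂ) := by
      funext z
      ext v
      rw [_root_.sum_apply]
      conv_lhs => rw [← Finset.univ_sum_single v, map_sum]
      refine Finset.sum_congr rfl fun j _ => ?_
      rw [smul_apply, ContinuousLinearMap.proj_apply, smul_eq_mul, mul_comm, ← smul_eq_mul,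
        ← map_smul]
      congr 1
      rw [← Pi.single_smul, smul_eq_mul, mul_one]
    rw [h]
    exact ContDiffOn.sum fun j _ => (ih (hg.fderiv_apply_const hU _)).smul contDiffOn_const

end SeveralComplexVariables

/-! ### Homogeneous expansions and completeness of the monomials. -/

section Reinhardt

variable {m : ℕ} {g : (Fin m → ℂ) → ℂ} {U : Set (Fin m → ℂ)}

theorem measurableEmbedding_torus_mul {c : Fin m → ℂ} (hc : ∀ j, ‖c j‖ = 1) :
    MeasurableEmbedding (fun z : Fin m → ℂ => c * z) :=
  (Homeomorph.piCongrRight fun j => Homeomorph.mulLeft₀ (c j)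
    (norm_ne_zero_iff.1 (by rw [hc j]; exact one_ne_zero))).measurableEmbedding

/-- Multiplication of the coordinates by unimodular constants preserves Lebesgue measure. -/
theorem measurePreserving_torus_mul {c : Fin m → ℂ} (hc : ∀ j, ‖c j‖ = 1)
    (hcU : ∀ z, c * z ∈ U ↔ z ∈ U) :
    MeasurePreserving (fun z : Fin m → ℂ => c * z) (volume.restrict U) (volume.restrict U) := by
  have h1 : ∀ j, MeasurePreserving (fun z : ℂ => c j * z) volume volume := fun j =>
    (rotation (⟨c j, mem_sphere_zero_iff_norm.2 (hc j)⟩ : Circle)).measurePreserving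
  have h2 : MeasurePreserving (fun z : Fin m → ℂ => c * z) volume volume :=
    volume_preserving_pi h1
  have h4 := h2.restrict_preimage_emb (measurableEmbedding_torus_mul hc) U
  have h5 : (fun z : Fin m → ℂ => c * z) ⁻¹' U = U := Set.ext fun z => hcU z
  rwa [h5] at h4

theorem setIntegral_comp_torus_mul {F : Type*} [NormedAddCommGroup F] [NormedSpace ℝ F]
    {c : Fin m → ℂ} (hc : ∀ j, ‖c j‖ = 1)
    (hcU : ∀ z, c * z ∈ U ↔ z ∈ U) (f : (Fin m → ℂ) → F) :
    ∫ z in U, f (c * z) = ∫ z in U, f z :=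
  (measurePreserving_torus_mul hc hcU).integral_comp (measurableEmbedding_torus_mul hc) f

/-- The homogeneous terms of the Taylor expansion at the origin. -/
noncomputable def taylorTerm (g : (Fin m → ℂ) → ℂ) (n : ℕ) (z : Fin m → ℂ) : ℂ :=
  ((n.factorial : ℂ))⁻¹ * iteratedFDeriv ℂ n g 0 fun _ => z

theorem continuous_taylorTerm (n : ℕ) : Continuous (taylorTerm g n) := by
  unfold taylorTerm
  exact continuous_const.mul
    ((iteratedFDeriv ℂ n g 0).cont.comp (continuous_pi fun _ => continuous_id))

theorem taylorTerm_smul (n : ℕ) (c : ℂ) (z : Fin m → ℂ) :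
    taylorTerm g n (c • z) = c ^ n * taylorTerm g n z := by
  unfold taylorTerm
  have := (iteratedFDeriv ℂ n g 0).map_smul_univ (fun _ => c) (fun _ => z)
  rw [this, Finset.prod_const, Finset.card_univ, Fintype.card_fin, smul_eq_mul]
  ring

/-- Multilinearity expands the term over all choices of a basis vector in each slot. Monomials may
repeat, which is harmless: only membership in their span is used. -/
theorem exists_taylorTerm_eq_sum_monomials (n : ℕ) :
    ∃ K : (Fin n → Fin m) → ℂ, ∃ α : (Fin n → Fin m) → Fin m → ℕ,
      ∀ z, taylorTerm g n z = ∑ r, K r * ∏ j, z j ^ α r j := by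
  classical
  refine ⟨fun r => ((n.factorial : ℂ))⁻¹ *
    iteratedFDeriv ℂ n g 0 fun i => (Pi.single (r i) 1 : Fin m → ℂ),
    fun r j => (Finset.univ.filter fun i => r i = j).card, fun z => ?_⟩
  have h1 : (fun _ : Fin n => z) = fun _ : Fin n => ∑ j, z j • (Pi.single j 1 : Fin m → ℂ) := by
    funext _
    conv_lhs => rw [← Finset.univ_sum_single z]
    refine Finset.sum_congr rfl fun j _ => ?_
    rw [← Pi.single_smul, smul_eq_mul, mul_one]
  unfold taylorTerm
  rw [h1, ContinuousMultilinearMap.map_sum, Finset.mul_sum]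
  refine Finset.sum_congr rfl fun r _ => ?_
  have h2 := (iteratedFDeriv ℂ n g 0).map_smul_univ (fun i => z (r i))
    (fun i => (Pi.single (r i) 1 : Fin m → ℂ))
  rw [h2, smul_eq_mul, mul_assoc, mul_comm (∏ i, z (r i))]
  congr 2
  rw [← Finset.prod_fiberwise (s := Finset.univ) (g := r) (f := fun i => z (r i))]
  refine Finset.prod_congr rfl fun j _ => ?_
  rw [← Finset.prod_const]
  refine Finset.prod_congr rfl fun i hi => ?_
  rw [(Finset.mem_filter.1 hi).2]

theorem iteratedFDeriv_comp_line (hg : DifferentiableOn ℂ g U) (hU : IsOpen U) (h0 : 0 ∈ U)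
    (n : ℕ) (z : Fin m → ℂ) :
    iteratedFDeriv ℂ n (fun w : ℂ => g (w • z)) 0 (fun _ => 1) =
      iteratedFDeriv ℂ n g 0 fun _ => z := by
  set L : ℂ →L[ℂ] (Fin m → ℂ) := ContinuousLinearMap.toSpanSingleton ℂ z with hL
  have hVo : IsOpen (L ⁻¹' U) := hU.preimage L.continuous
  have h0' : (0 : ℂ) ∈ L ⁻¹' U := by simpa using h0
  have h1 := L.iteratedFDerivWithin_comp_right (hg.contDiffOn_pi hU n) hU.uniqueDiffOn
    hVo.uniqueDiffOn (x := 0) (by simpa using h0) (i := n) le_rfl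
  rw [iteratedFDerivWithin_of_isOpen n hVo h0',
    iteratedFDerivWithin_of_isOpen n hU (by simpa using h0)] at h1
  have h2 : (fun w : ℂ => g (w • z)) = g ∘ L := by
    funext w
    simp [hL]
  rw [h2, h1]
  simp [hL]

variable (hU : IsOpen U) (hbal : ∀ w : ℂ, ‖w‖ ≤ 1 → ∀ z ∈ U, w • z ∈ U)

-- Restricting `g` to the complex line through `z` reduces to the one-variable Taylor series at `w =
-- 1`. Openness and balancedness give a disc of radius larger than `1`, so `1` is an interior point.
include hU hbal in
theorem hasSum_taylorTerm (hg : DifferentiableOn ℂ g U) {z : Fin m → ℂ} (hz : z ∈ U) :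
    HasSum (fun n => taylorTerm g n z) (g z) := by
  have h0 : (0 : Fin m → ℂ) ∈ U := by simpa using hbal 0 (by simp) z hz
  obtain ⟨r, hr1, hrz⟩ : ∃ r : ℝ, 1 < r ∧ (r : ℂ) • z ∈ U := by
    have hc : ContinuousAt (fun r : ℝ => (r : ℂ) • z) 1 := by fun_prop
    have h1 : ∀ᶠ r : ℝ in nhds 1, (r : ℂ) • z ∈ U :=
      hc.eventually (hU.mem_nhds (by simpa using hz))
    have h2 : ∀ᶠ r : ℝ in nhdsWithin 1 (Set.Ioi 1), (r : ℂ) • z ∈ U :=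
      h1.filter_mono nhdsWithin_le_nhds
    obtain ⟨r, hr⟩ := (h2.and self_mem_nhdsWithin).exists
    exact ⟨r, hr.2, hr.1⟩
  have hd : DifferentiableOn ℂ (fun w : ℂ => g (w • z)) (Metric.ball 0 r) := by
    refine hg.comp (by fun_prop) fun w hw => ?_
    have hr0 : (r : ℂ) ≠ 0 := by
      rw [Complex.ofReal_ne_zero]; linarith
    have h1 := hbal (w / r) (by
      rw [norm_div, Complex.norm_real, Real.norm_of_nonneg (by linarith),
        div_le_one (by linarith)]
      exact (by simpa using hw : ‖w‖ < r).le) _ hrz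
    rwa [smul_smul, div_mul_cancel₀ _ hr0] at h1
  have h := Complex.hasSum_taylorSeries_on_ball hd (z := 1) (by simpa using hr1)
  simp only [sub_zero, one_pow, one_mul, iteratedDeriv_eq_iteratedFDeriv, smul_eq_mul] at h
  simp only [iteratedFDeriv_comp_line hg hU h0] at h
  rw [one_smul] at h
  exact h

include hU hbal in
theorem taylorTerm_eq_integral (hg : DifferentiableOn ℂ g U) {z : Fin m → ℂ} (hz : z ∈ U)
    (n : ℕ) : ∫ θ in (0 : ℝ)..2 * Real.pi, (circleMap 0 1 θ)⁻¹ ^ n * g (circleMap 0 1 θ • z) =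
      2 * Real.pi * taylorTerm g n z := by
  have h0 : (0 : Fin m → ℂ) ∈ U := by simpa using hbal 0 (by simp) z hz
  have hd : DifferentiableOn ℂ (fun w : ℂ => g (w • z)) (Metric.closedBall 0 (1 : NNReal)) := by
    refine hg.comp (by fun_prop) fun w hw => hbal w (by simpa using hw) z hz
  have h1 := (hd.hasFPowerSeriesOnBall one_pos).factorial_smul 1 n
  rw [iteratedFDeriv_comp_line hg hU h0, cauchyPowerSeries_apply] at h1
  have hf : ((n.factorial : ℂ)) ≠ 0 := by exact_mod_cast n.factorial_ne_zero
  have hpi : (2 * Real.pi * Complex.I : ℂ) ≠ 0 := Complex.two_pi_I_ne_zero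
  rw [taylorTerm, ← h1, nsmul_eq_mul, inv_mul_cancel_left₀ hf, circleIntegral]
  have hI : ∀ X : ℂ, 2 * (Real.pi : ℂ) * ((2 * Real.pi * Complex.I)⁻¹ • X) = Complex.I⁻¹ * X := by
    intro X
    have : (Real.pi : ℂ) ≠ 0 := by exact_mod_cast Real.pi_ne_zero
    rw [smul_eq_mul]
    field_simp
  rw [hI, ← intervalIntegral.integral_const_mul]
  refine intervalIntegral.integral_congr fun θ _ => ?_
  have hc : circleMap 0 1 θ ≠ 0 := circleMap_ne_center one_ne_zero
  simp only [deriv_circleMap, sub_zero, smul_eq_mul, NNReal.coe_one, one_div]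
  field_simp

include hU hbal in
/-- An integrable holomorphic function on a bounded balanced Reinhardt domain which is orthogonal
to all monomials vanishes. -/
theorem eq_zero_of_integral_monomial_eq_zero (hbdd : Bornology.IsBounded U)
    (hg : DifferentiableOn ℂ g U) (hgi : IntegrableOn g U)
    (horth : ∀ α : Fin m → ℕ, ∫ z in U, (starRingEnd ℂ) (∏ j, z j ^ α j) * g z = 0) :
    ∀ᵐ z ∂(volume.restrict U), g z = 0 := by
  have hint : ∀ f : (Fin m → ℂ) → ℂ, Continuous f →
      IntegrableOn (fun z => (starRingEnd ℂ) (f z) * g z) U := by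
    intro f hf
    obtain ⟨R, hR⟩ := hbdd.subset_closedBall 0
    obtain ⟨B, hB⟩ := (isCompact_closedBall (0 : Fin m → ℂ) R).exists_bound_of_continuousOn
      hf.continuousOn
    refine Integrable.bdd_mul (c := B) hgi (by fun_prop) ?_
    filter_upwards [ae_restrict_mem hU.measurableSet] with z hz
    rw [RCLike.norm_conj]
    exact hB z (hR hz)
  have horthP : ∀ n, ∫ z in U, (starRingEnd ℂ) (taylorTerm g n z) * g z = 0 := by
    intro n
    obtain ⟨K, α, hK⟩ := exists_taylorTerm_eq_sum_monomials (g := g) n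
    simp_rw [hK, map_sum, Finset.sum_mul, map_mul, mul_assoc]
    rw [integral_finsetSum]
    · refine Finset.sum_eq_zero fun r _ => ?_
      rw [integral_const_mul, horth, mul_zero]
    · intro r _
      exact (hint _ (by fun_prop)).const_mul _
  have hcirc : ∀ θ : ℝ, ‖circleMap 0 1 θ‖ = 1 := fun θ => by simp
  have hcU : ∀ θ : ℝ, ∀ z, (fun _ => circleMap 0 1 θ) * z ∈ U ↔ z ∈ U := by
    intro θ z
    have he : (fun _ => circleMap 0 1 θ) * z = circleMap 0 1 θ • z := rfl
    rw [he]
    refine ⟨fun h => ?_, fun h => hbal _ (hcirc θ).le z h⟩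
    have := hbal (circleMap 0 1 θ)⁻¹ (by rw [norm_inv, hcirc, inv_one]) _ h
    rwa [inv_smul_smul₀ (circleMap_ne_center one_ne_zero)] at this
  have hzero : ∀ n, ∀ᵐ z ∂(volume.restrict U), taylorTerm g n z = 0 := by
    intro n
    -- By homogeneity `G z θ` is `conj(P_n) g` evaluated at the rotated point, with `P_n` the `n`-th
    -- Taylor term. Its integral over `z` is therefore independent of `θ` and zero by orthogonality,
    -- while its integral over `θ` is `2π |P_n(z)|²`. Fubini then kills `P_n` without any `L²`
    -- convergence of the expansion.
    set G : (Fin m → ℂ) → ℝ → ℂ := fun z θ =>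
      (starRingEnd ℂ) (taylorTerm g n z) * ((circleMap 0 1 θ)⁻¹ ^ n * g (circleMap 0 1 θ • z))
      with hG
    have hGθ : ∀ θ z, G z θ = (starRingEnd ℂ) (taylorTerm g n (circleMap 0 1 θ • z)) *
        g (circleMap 0 1 θ • z) := by
      intro θ z
      have : (starRingEnd ℂ) (circleMap 0 1 θ) = (circleMap 0 1 θ)⁻¹ :=
        (Complex.inv_eq_conj (hcirc θ)).symm
      rw [taylorTerm_smul, map_mul, map_pow, this, hG]
      ring
    have hG0 : ∀ θ, ∫ z in U, G z θ = 0 := by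
      intro θ
      simp_rw [hGθ]
      exact (setIntegral_comp_torus_mul (fun _ => hcirc θ) (hcU θ)
        (fun z => (starRingEnd ℂ) (taylorTerm g n z) * g z)).trans (horthP n)
    have hGn : ∀ θ, ∫ z in U, ‖G z θ‖ = ∫ z in U, ‖(starRingEnd ℂ) (taylorTerm g n z) * g z‖ := by
      intro θ
      simp_rw [hGθ]
      exact setIntegral_comp_torus_mul (fun _ => hcirc θ) (hcU θ)
        (fun z => ‖(starRingEnd ℂ) (taylorTerm g n z) * g z‖)
    have hcont : ContinuousOn (Function.uncurry G) (U ×ˢ Set.univ) := by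
      have h1 := continuous_circleMap 0 1
      have h2 := continuous_taylorTerm (g := g) n
      have h3 : Continuous fun θ : ℝ => (circleMap 0 1 θ)⁻¹ :=
        h1.inv₀ fun θ => circleMap_ne_center one_ne_zero
      have h4 : ContinuousOn (fun x : (Fin m → ℂ) × ℝ => g (circleMap 0 1 x.2 • x.1))
          (U ×ˢ Set.univ) := by
        refine hg.continuousOn.comp (Continuous.continuousOn (by fun_prop)) ?_
        rintro ⟨z, θ⟩ ⟨hz, -⟩
        exact hbal _ (hcirc θ).le z hz
      refine ContinuousOn.mul (Continuous.continuousOn ?_)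
        (ContinuousOn.mul (Continuous.continuousOn ?_) h4)
      · exact Complex.continuous_conj.comp (h2.comp continuous_fst)
      · exact (h3.comp continuous_snd).pow n
    have hmeas : AEStronglyMeasurable (Function.uncurry G)
        ((volume.restrict U).prod (volume.restrict (Set.Ioc 0 (2 * Real.pi)))) := by
      rw [Measure.prod_restrict]
      exact (hcont.mono (Set.prod_mono subset_rfl (Set.subset_univ _))).aestronglyMeasurable
        (hU.measurableSet.prod measurableSet_Ioc)
    have hGint : Integrable (Function.uncurry G)
        ((volume.restrict U).prod (volume.restrict (Set.Ioc 0 (2 * Real.pi)))) := by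
      rw [integrable_prod_iff' hmeas]
      constructor
      · refine Filter.Eventually.of_forall fun θ => ?_
        simp only [Function.uncurry_apply_pair, hGθ]
        exact (measurePreserving_torus_mul (fun _ => hcirc θ) (hcU θ)).integrable_comp_of_integrable
          (hint _ (continuous_taylorTerm n))
      · simp only [Function.uncurry_apply_pair, hGn]
        exact integrable_const _
    have hswap := integral_integral_swap hGint
    simp only [hG0, integral_zero] at hswap
    have h5 : ∫ z in U, (‖taylorTerm g n z‖ ^ 2 : ℝ) = 0 := by
      have h6 : ∀ z ∈ U, ∫ θ in Set.Ioc 0 (2 * Real.pi), G z θ =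
          ((2 * Real.pi * ‖taylorTerm g n z‖ ^ 2 : ℝ) : ℂ) := by
        intro z hz
        have h7 := taylorTerm_eq_integral hU hbal hg hz n
        rw [intervalIntegral.integral_of_le (by positivity)] at h7
        simp only [hG]
        rw [integral_const_mul, h7, mul_left_comm, ← Complex.normSq_eq_conj_mul_self,
          Complex.normSq_eq_norm_sq]
        push_cast
        rfl
      rw [setIntegral_congr_fun hU.measurableSet h6, integral_complex_ofReal] at hswap
      have h8 : ∫ z in U, 2 * Real.pi * ‖taylorTerm g n z‖ ^ 2 = 0 := by exact_mod_cast hswap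
      rw [integral_const_mul] at h8
      exact (mul_eq_zero.1 h8).resolve_left (by positivity)
    have hi : IntegrableOn (fun z => ‖taylorTerm g n z‖ ^ 2) U := by
      obtain ⟨R, hR⟩ := hbdd.subset_closedBall 0
      refine (ContinuousOn.integrableOn_compact (isCompact_closedBall 0 R) ?_).mono_set hR
      exact ((continuous_taylorTerm n).norm.pow 2).continuousOn
    have h9 := (integral_eq_zero_iff_of_nonneg (fun z => by positivity) hi).1 h5
    filter_upwards [h9] with z hz
    simpa using hz
  filter_upwards [ae_all_iff.2 hzero, ae_restrict_mem hU.measurableSet] with z hz hzU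
  have h := hasSum_taylorTerm hU hbal hg hzU
  simp_rw [hz] at h
  exact h.unique hasSum_zero

end Reinhardt

/-! ### Norms of the monomials on the egg domain. -/

section MonomialNorms

variable {m : ℕ}

theorem integral_complex_norm_rpow_mul_exp {p : ℝ} (hp : 0 < p) (n : ℕ) :
    ∫ z : ℂ, (‖z‖ ^ n) ^ 2 * Real.exp (-‖z‖ ^ (2 * p)) =
      Real.pi / p * Real.Gamma ((n + 1) / p) := by
  have h := integral_fun_norm_addHaar (volume : Measure ℂ)
    (fun r : ℝ => (r ^ n) ^ 2 * Real.exp (-r ^ (2 * p)))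
  rw [h, Complex.finrank_real_complex]
  have h1 : ∫ y in Set.Ioi (0 : ℝ), y ^ (2 - 1) • ((y ^ n) ^ 2 * Real.exp (-y ^ (2 * p))) =
      1 / (2 * p) * Real.Gamma (((2 * n + 1 : ℝ) + 1) / (2 * p)) := by
    rw [← integral_rpow_mul_exp_neg_rpow (by positivity) (by
      have : (0 : ℝ) ≤ n := by positivity
      linarith)]
    refine setIntegral_congr_fun measurableSet_Ioi fun y hy => ?_
    have hy' : (0 : ℝ) < y := hy
    have : y ^ (2 * n + 1 : ℝ) = y ^ (2 * n + 1) := by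
      rw [← Real.rpow_natCast]; push_cast; rfl
    simp only [this, smul_eq_mul]
    ring
  have h2 : (volume : Measure ℂ).real (Metric.ball 0 1) = Real.pi := by
    rw [measureReal_def, Complex.volume_ball]
    simp
  rw [h1, h2, show ((2 * n + 1 : ℝ) + 1) / (2 * p) = (n + 1) / p by field_simp; ring]
  simp only [smul_eq_mul, nsmul_eq_mul]
  field_simp
  norm_num

/-- The defining function of the egg domain. -/
noncomputable def eggGauge (p : Fin m → ℝ) (z : Fin m → ℂ) : ℝ := ∑ j, ‖z j‖ ^ (2 * p j)

theorem continuous_eggGauge {p : Fin m → ℝ} (hp : ∀ j, 0 < p j) : Continuous (eggGauge p) :=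
  continuous_finsetSum _ fun j _ =>
    (continuous_apply j).norm.rpow_const fun _ => Or.inr (by have := hp j; positivity)

/-- The parameters `(α_j + 1) / p_j`. -/
noncomputable def eggParam (p : Fin m → ℝ) (α : Fin m → ℕ) (j : Fin m) : ℝ := (α j + 1) / p j

theorem eggParam_pos {p : Fin m → ℝ} (hp : ∀ j, 0 < p j) (α : Fin m → ℕ) (j : Fin m) :
    0 < eggParam p α j := by
  have := hp j
  unfold eggParam
  positivity

theorem lintegral_comp_diagonal {c : Fin m → ℝ} (hc : ∀ j, 0 < c j) {h : (Fin m → ℂ) → ℝ≥0∞}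
    (hh : Measurable h) :
    ∫⁻ z, h z = ENNReal.ofReal (∏ j, c j ^ 2) * ∫⁻ z : Fin m → ℂ, h (fun j => c j • z j) := by
  have hD : Measurable fun z : Fin m → ℂ => fun j => c j • z j := by fun_prop
  have h1 : (volume : Measure (Fin m → ℂ)) = ENNReal.ofReal (∏ j, c j ^ 2) •
      Measure.map (fun z : Fin m → ℂ => fun j => c j • z j) volume := by
    refine Measure.pi_eq fun s hs => ?_
    have h2 : (fun z : Fin m → ℂ => fun j => c j • z j) ⁻¹' (Set.univ.pi s) =
        Set.univ.pi fun j => (fun x : ℂ => c j • x) ⁻¹' s j := by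
      ext z; simp
    rw [Measure.smul_apply, Measure.map_apply hD (MeasurableSet.univ_pi hs), h2, volume_pi_pi,
      smul_eq_mul, ENNReal.ofReal_prod_of_nonneg fun j _ => sq_nonneg _, ← Finset.prod_mul_distrib]
    refine Finset.prod_congr rfl fun j _ => ?_
    have := hc j
    rw [Measure.addHaar_preimage_smul _ (hc j).ne', Complex.finrank_real_complex, ← mul_assoc,
      ← ENNReal.ofReal_mul (by positivity), abs_of_pos (by positivity), mul_inv_cancel₀
      (by positivity), ENNReal.ofReal_one, one_mul]
  conv_lhs => rw [h1]
  rw [lintegral_smul_measure, lintegral_map hh hD, smul_eq_mul]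

/-- The dilation `z_j ↦ t^(1/(2p_j)) z_j` multiplies the gauge by `t`. Its Jacobian contributes
`t^(1/p_j)` and the integrand `t^(α_j/p_j)` in each coordinate. -/
theorem lintegral_monomial_lt {p : Fin m → ℝ} (hp : ∀ j, 0 < p j) (α : Fin m → ℕ) {t : ℝ}
    (ht : 0 < t) :
    ∫⁻ z in {z | eggGauge p z < t}, ENNReal.ofReal (‖∏ j, z j ^ α j‖ ^ 2) =
      ENNReal.ofReal (t ^ (∑ j, eggParam p α j)) *
        ∫⁻ z in {z | eggGauge p z < 1}, ENNReal.ofReal (‖∏ j, z j ^ α j‖ ^ 2) := by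
  have hmeas : ∀ t, MeasurableSet {z | eggGauge p z < t} := fun t =>
    (isOpen_lt (continuous_eggGauge hp) continuous_const).measurableSet
  have hf : Measurable fun z : Fin m → ℂ => ENNReal.ofReal (‖∏ j, z j ^ α j‖ ^ 2) := by fun_prop
  rw [← lintegral_indicator (hmeas t), ← lintegral_indicator (hmeas 1)]
  set c : Fin m → ℝ := fun j => t ^ (1 / (2 * p j)) with hc
  have hc0 : ∀ j, 0 < c j := fun j => by positivity
  rw [lintegral_comp_diagonal hc0 (hf.indicator (hmeas t))]
  have hg : ∀ z : Fin m → ℂ, eggGauge p (fun j => c j • z j) = t * eggGauge p z := by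
    intro z
    unfold eggGauge
    rw [Finset.mul_sum]
    refine Finset.sum_congr rfl fun j _ => ?_
    have := hp j
    rw [norm_smul, Real.norm_of_nonneg (hc0 j).le, Real.mul_rpow (hc0 j).le (norm_nonneg _), hc,
      ← Real.rpow_mul ht.le, one_div_mul_cancel (by positivity), Real.rpow_one]
  have hi : ∀ z : Fin m → ℂ, ({z | eggGauge p z < t}.indicator
      (fun z => ENNReal.ofReal (‖∏ j, z j ^ α j‖ ^ 2)) fun j => c j • z j) =
      ENNReal.ofReal (∏ j, (c j ^ α j) ^ 2) * {z | eggGauge p z < 1}.indicator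
      (fun z => ENNReal.ofReal (‖∏ j, z j ^ α j‖ ^ 2)) z := by
    intro z
    have hiff : eggGauge p (fun j => c j • z j) < t ↔ eggGauge p z < 1 := by
      rw [hg, mul_lt_iff_lt_one_right ht]
    by_cases h : eggGauge p z < 1
    · rw [Set.indicator_of_mem (show _ ∈ {z | eggGauge p z < t} from hiff.2 h),
        Set.indicator_of_mem (show z ∈ {z | eggGauge p z < 1} from h),
        ← ENNReal.ofReal_mul (Finset.prod_nonneg fun _ _ => sq_nonneg _), Finset.prod_pow, ← mul_pow]
      congr 2
      rw [norm_prod, norm_prod, ← Finset.prod_mul_distrib]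
      refine Finset.prod_congr rfl fun j _ => ?_
      rw [norm_pow, norm_smul, Real.norm_of_nonneg (hc0 j).le, mul_pow, norm_pow]
    · rw [Set.indicator_of_notMem (show _ ∉ {z | eggGauge p z < t} from fun h' => h (hiff.1 h')),
        Set.indicator_of_notMem (show z ∉ {z | eggGauge p z < 1} from h), mul_zero]
  simp_rw [hi]
  rw [lintegral_const_mul _ (hf.indicator (hmeas 1)), ← mul_assoc,
    ← ENNReal.ofReal_mul (Finset.prod_nonneg fun _ _ => sq_nonneg _), ← Finset.prod_mul_distrib]
  congr 2
  rw [Real.rpow_sum_of_pos ht]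
  refine Finset.prod_congr rfl fun j _ => ?_
  have := hp j
  rw [← mul_pow, mul_comm, ← pow_succ, hc, ← pow_mul, ← Real.rpow_natCast, ← Real.rpow_mul ht.le]
  congr 1
  unfold eggParam
  push_cast
  field_simp

theorem lintegral_monomial_mul_exp {p : Fin m → ℝ} (hp : ∀ j, 0 < p j) (α : Fin m → ℕ) :
    ∫⁻ z : Fin m → ℂ, ENNReal.ofReal (‖∏ j, z j ^ α j‖ ^ 2) *
        ENNReal.ofReal (Real.exp (-eggGauge p z)) =
      ENNReal.ofReal (∏ j, (Real.pi / p j * Real.Gamma (eggParam p α j))) := by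
  have hJ : ∀ j, ∫ z : ℂ, (‖z‖ ^ α j) ^ 2 * Real.exp (-‖z‖ ^ (2 * p j)) =
      Real.pi / p j * Real.Gamma (eggParam p α j) := fun j =>
    integral_complex_norm_rpow_mul_exp (hp j) (α j)
  have hpos : ∀ j, 0 < Real.pi / p j * Real.Gamma (eggParam p α j) := fun j =>
    mul_pos (div_pos Real.pi_pos (hp j)) (Real.Gamma_pos_of_pos (eggParam_pos hp α j))
  have hint : ∀ j, Integrable fun z : ℂ => (‖z‖ ^ α j) ^ 2 * Real.exp (-‖z‖ ^ (2 * p j)) :=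
    fun j => Integrable.of_integral_ne_zero (by rw [hJ j]; exact (hpos j).ne')
  have hfun : (fun z : Fin m → ℂ => ‖∏ j, z j ^ α j‖ ^ 2 * Real.exp (-eggGauge p z)) =
      fun z => ∏ j, ((‖z j‖ ^ α j) ^ 2 * Real.exp (-‖z j‖ ^ (2 * p j))) := by
    funext z
    rw [Finset.prod_mul_distrib, ← Real.exp_sum, Finset.sum_neg_distrib, Finset.prod_pow,
      norm_prod]
    simp only [norm_pow, eggGauge]
  have hint' : Integrable (fun z : Fin m → ℂ =>
      ∏ j, ((‖z j‖ ^ α j) ^ 2 * Real.exp (-‖z j‖ ^ (2 * p j)))) volume :=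
    Integrable.fintype_prod (𝕜 := ℝ)
      (f := fun j (z : ℂ) => (‖z‖ ^ α j) ^ 2 * Real.exp (-‖z‖ ^ (2 * p j))) hint
  simp_rw [← hJ]
  rw [← integral_fintype_prod_volume_eq_prod (𝕜 := ℝ)
      (f := fun j (z : ℂ) => (‖z‖ ^ α j) ^ 2 * Real.exp (-‖z‖ ^ (2 * p j))),
    ofReal_integral_eq_lintegral_ofReal hint'
      (Filter.Eventually.of_forall fun z => Finset.prod_nonneg fun j _ => by positivity)]
  refine lintegral_congr fun z => ?_
  rw [← congrFun hfun z, ENNReal.ofReal_mul (by positivity)]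

/-- Write `exp(-G)` as the integral of `exp(-t)` over `t > G` and use Tonelli; the scaling of
sublevel sets leaves `∫ exp(-t) t^S dt = Γ(S+1)`. Comparison with the product formula
`lintegral_monomial_mul_exp` yields the norms. -/
theorem lintegral_monomial_mul_exp_eq_layers {p : Fin m → ℝ} (hp : ∀ j, 0 < p j)
    (α : Fin m → ℕ) :
    ∫⁻ z : Fin m → ℂ, ENNReal.ofReal (‖∏ j, z j ^ α j‖ ^ 2) *
        ENNReal.ofReal (Real.exp (-eggGauge p z)) =
      ENNReal.ofReal (Real.Gamma ((∑ j, eggParam p α j) + 1)) *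
        ∫⁻ z in {z | eggGauge p z < 1}, ENNReal.ofReal (‖∏ j, z j ^ α j‖ ^ 2) := by
  have hf : Measurable fun z : Fin m → ℂ => ENNReal.ofReal (‖∏ j, z j ^ α j‖ ^ 2) := by fun_prop
  have hG := (continuous_eggGauge hp).measurable
  have hS : 0 ≤ ∑ j, eggParam p α j := Finset.sum_nonneg fun j _ => (eggParam_pos hp α j).le
  have hnn : ∀ z, 0 ≤ eggGauge p z := fun z =>
    Finset.sum_nonneg fun j _ => Real.rpow_nonneg (norm_nonneg _) _
  have hexp : ∀ z, ENNReal.ofReal (Real.exp (-eggGauge p z)) =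
      ∫⁻ t in Set.Ioi (0 : ℝ), {t | eggGauge p z < t}.indicator
        (fun t => ENNReal.ofReal (Real.exp (-t))) t := by
    intro z
    rw [← integral_exp_neg_Ioi, ofReal_integral_eq_lintegral_ofReal
      (integrableOn_exp_neg_Ioi _) (Filter.Eventually.of_forall fun t => (Real.exp_pos _).le)]
    have : {t | eggGauge p z < t} = Set.Ioi (eggGauge p z) := rfl
    rw [this, setLIntegral_indicator measurableSet_Ioi, Set.inter_eq_left.2
      (Set.Ioi_subset_Ioi (hnn z))]
  simp_rw [hexp]
  have hstep : ∀ z, ENNReal.ofReal (‖∏ j, z j ^ α j‖ ^ 2) *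
      ∫⁻ t in Set.Ioi (0 : ℝ), {t | eggGauge p z < t}.indicator
        (fun t => ENNReal.ofReal (Real.exp (-t))) t =
      ∫⁻ t in Set.Ioi (0 : ℝ), {x : (Fin m → ℂ) × ℝ | eggGauge p x.1 < x.2}.indicator
        (fun x => ENNReal.ofReal (‖∏ j, x.1 j ^ α j‖ ^ 2) *
          ENNReal.ofReal (Real.exp (-x.2))) (z, t) := by
    intro z
    rw [← lintegral_const_mul']
    · refine lintegral_congr fun t => ?_
      by_cases h : eggGauge p z < t
      · rw [Set.indicator_of_mem (show t ∈ {t | eggGauge p z < t} from h),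
          Set.indicator_of_mem (show (z, t) ∈ {x : (Fin m → ℂ) × ℝ | eggGauge p x.1 < x.2} from h)]
      · rw [Set.indicator_of_notMem (show t ∉ {t | eggGauge p z < t} from h),
          Set.indicator_of_notMem
            (show (z, t) ∉ {x : (Fin m → ℂ) × ℝ | eggGauge p x.1 < x.2} from h), mul_zero]
    · exact ENNReal.ofReal_ne_top
  simp_rw [hstep]
  rw [lintegral_lintegral_swap]
  · have hin : ∀ t ∈ Set.Ioi (0 : ℝ), ∫⁻ z : Fin m → ℂ,
        {x : (Fin m → ℂ) × ℝ | eggGauge p x.1 < x.2}.indicator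
        (fun x => ENNReal.ofReal (‖∏ j, x.1 j ^ α j‖ ^ 2) *
          ENNReal.ofReal (Real.exp (-x.2))) (z, t) =
        ENNReal.ofReal (Real.exp (-t) * t ^ ((∑ j, eggParam p α j) + 1 - 1)) *
        ∫⁻ z in {z | eggGauge p z < 1}, ENNReal.ofReal (‖∏ j, z j ^ α j‖ ^ 2) := by
      intro t ht
      have ht' : 0 < t := ht
      rw [add_sub_cancel_right, ENNReal.ofReal_mul (Real.exp_pos _).le, mul_assoc,
        ← lintegral_monomial_lt hp α ht', ← lintegral_indicator
          (isOpen_lt (continuous_eggGauge hp) continuous_const).measurableSet,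
        ← lintegral_const_mul' _ _ ENNReal.ofReal_ne_top]
      refine lintegral_congr fun z => ?_
      by_cases h : eggGauge p z < t
      · rw [Set.indicator_of_mem (show z ∈ {z | eggGauge p z < t} from h),
          Set.indicator_of_mem (show (z, t) ∈ {x : (Fin m → ℂ) × ℝ | eggGauge p x.1 < x.2} from h),
          mul_comm]
      · rw [Set.indicator_of_notMem (show z ∉ {z | eggGauge p z < t} from h),
          Set.indicator_of_notMem
            (show (z, t) ∉ {x : (Fin m → ℂ) × ℝ | eggGauge p x.1 < x.2} from h), mul_zero]
    rw [setLIntegral_congr_fun measurableSet_Ioi hin, lintegral_mul_const _ (by fun_prop),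
      ← ofReal_integral_eq_lintegral_ofReal (Real.GammaIntegral_convergent (by linarith)),
      ← Real.Gamma_eq_integral (by linarith)]
    filter_upwards [ae_restrict_mem measurableSet_Ioi] with t ht
    have : (0 : ℝ) < t := ht
    positivity
  · refine (Measurable.indicator ?_ ?_).aemeasurable
    · exact (hf.comp measurable_fst).mul (by fun_prop)
    · exact measurableSet_lt (hG.comp measurable_fst) measurable_snd

/-- The squared norm of the monomial `z^α` in the Bergman space of the egg domain. -/
noncomputable def monomialNormSq (p : Fin m → ℝ) (α : Fin m → ℕ) : ℝ :=
  (∏ j, (Real.pi / p j * Real.Gamma (eggParam p α j))) /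
    Real.Gamma ((∑ j, eggParam p α j) + 1)

theorem sum_eggParam_nonneg {p : Fin m → ℝ} (hp : ∀ j, 0 < p j) (α : Fin m → ℕ) :
    0 ≤ ∑ j, eggParam p α j := Finset.sum_nonneg fun j _ => (eggParam_pos hp α j).le

theorem monomialNormSq_pos {p : Fin m → ℝ} (hp : ∀ j, 0 < p j) (α : Fin m → ℕ) :
    0 < monomialNormSq p α := by
  refine div_pos (Finset.prod_pos fun j _ => ?_) (Real.Gamma_pos_of_pos ?_)
  · exact mul_pos (div_pos Real.pi_pos (hp j)) (Real.Gamma_pos_of_pos (eggParam_pos hp α j))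
  · linarith [sum_eggParam_nonneg hp α]

theorem setIntegral_norm_monomial_sq {p : Fin m → ℝ} (hp : ∀ j, 0 < p j) (α : Fin m → ℕ) :
    ∫ z in (eggDomain p hp : Set (Fin m → ℂ)), ‖∏ j, z j ^ α j‖ ^ 2 = monomialNormSq p α := by
  have h := lintegral_monomial_mul_exp hp α
  rw [lintegral_monomial_mul_exp_eq_layers hp α] at h
  have hΓ : 0 < Real.Gamma ((∑ j, eggParam p α j) + 1) :=
    Real.Gamma_pos_of_pos (by linarith [sum_eggParam_nonneg hp α])
  have hset : (eggDomain p hp : Set (Fin m → ℂ)) = {z | eggGauge p z < 1} := rfl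
  rw [hset, integral_eq_lintegral_of_nonneg_ae
    (Filter.Eventually.of_forall fun z => by positivity)
    (Continuous.aestronglyMeasurable (by fun_prop)), monomialNormSq, eq_div_iff hΓ.ne', mul_comm]
  have h2 := congrArg ENNReal.toReal h
  rwa [ENNReal.toReal_mul, ENNReal.toReal_ofReal hΓ.le, ENNReal.toReal_ofReal] at h2
  refine Finset.prod_nonneg fun j _ => ?_
  exact (mul_pos (div_pos Real.pi_pos (hp j)) (Real.Gamma_pos_of_pos (eggParam_pos hp α j))).le

end MonomialNorms

/-! ### The monomial Hilbert basis and the action of the coordinates. -/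

section MonomialBasis

variable {m : ℕ} {p : Fin m → ℝ} (hp : ∀ j, 0 < p j)

theorem smul_mem_eggDomain {w : ℂ} (hw : ‖w‖ ≤ 1) {z : Fin m → ℂ} (hz : z ∈ eggDomain p hp) :
    w • z ∈ eggDomain p hp := by
  have hz' : ∑ j, ‖z j‖ ^ (2 * p j) < 1 := hz
  refine lt_of_le_of_lt (Finset.sum_le_sum fun j _ => ?_) hz'
  have := hp j
  refine Real.rpow_le_rpow (norm_nonneg _) ?_ (by positivity)
  rw [Pi.smul_apply, norm_smul]
  exact mul_le_of_le_one_left (norm_nonneg _) hw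

theorem torus_mul_mem_eggDomain_iff {c : Fin m → ℂ} (hc : ∀ j, ‖c j‖ = 1) (z : Fin m → ℂ) :
    c * z ∈ (eggDomain p hp : Set (Fin m → ℂ)) ↔ z ∈ (eggDomain p hp : Set (Fin m → ℂ)) := by
  change ∑ j, ‖(c * z) j‖ ^ (2 * p j) < 1 ↔ ∑ j, ‖z j‖ ^ (2 * p j) < 1
  simp [hc]

instance isFiniteMeasure_restrict_eggDomain :
    IsFiniteMeasure ((volume : Measure (Fin m → ℂ)).restrict (eggDomain p hp)) :=
  ⟨by
    rw [Measure.restrict_apply_univ]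
    exact (isBounded_eggDomain p hp).measure_lt_top⟩

theorem memLp_monomial (α : Fin m → ℕ) (q : ℝ≥0∞) :
    MemLp (fun z : Fin m → ℂ => ∏ j, z j ^ α j) q
      ((volume : Measure (Fin m → ℂ)).restrict (eggDomain p hp)) := by
  have hc : Continuous fun z : Fin m → ℂ => ∏ j, z j ^ α j := by fun_prop
  obtain ⟨R, hR⟩ := (isBounded_eggDomain p hp).subset_closedBall 0
  obtain ⟨B, hB⟩ := (isCompact_closedBall (0 : Fin m → ℂ) R).exists_bound_of_continuousOn
    hc.continuousOn
  refine MemLp.of_bound hc.aestronglyMeasurable B ?_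
  filter_upwards [ae_restrict_mem (eggDomain p hp).isOpen.measurableSet] with z hz
  exact hB z (hR hz)

/-- The monomial `z^α` as an element of the Bergman space. -/
noncomputable def bergmanMonomial (α : Fin m → ℕ) : bergmanSpace (eggDomain p hp) :=
  ⟨(memLp_monomial hp α 2).toLp, fun z => ∏ j, z j ^ α j,
    Differentiable.differentiableOn (by fun_prop), (memLp_monomial hp α 2).coeFn_toLp⟩

theorem bergmanMonomial_ae_eq (α : Fin m → ℕ) :
    (bergmanMonomial hp α).1 =ᵐ[(volume : Measure (Fin m → ℂ)).restrict (eggDomain p hp)]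
      fun z => ∏ j, z j ^ α j :=
  (memLp_monomial hp α 2).coeFn_toLp

theorem inner_bergmanMonomial (α : Fin m → ℕ) (f : bergmanSpace (eggDomain p hp))
    {g : (Fin m → ℂ) → ℂ}
    (hg : f.1 =ᵐ[(volume : Measure (Fin m → ℂ)).restrict (eggDomain p hp)] g) :
    inner ℂ (bergmanMonomial hp α) f =
      ∫ z in (eggDomain p hp : Set (Fin m → ℂ)), (starRingEnd ℂ) (∏ j, z j ^ α j) * g z := by
  rw [Submodule.coe_inner, MeasureTheory.L2.inner_def]
  refine integral_congr_ae ?_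
  filter_upwards [bergmanMonomial_ae_eq hp α, hg] with z h1 h2
  rw [h1, h2, RCLike.inner_apply, mul_comm]

theorem inner_bergmanMonomial_self (α : Fin m → ℕ) :
    inner ℂ (bergmanMonomial hp α) (bergmanMonomial hp α) = (monomialNormSq p α : ℂ) := by
  rw [inner_bergmanMonomial hp α _ (bergmanMonomial_ae_eq hp α),
    ← setIntegral_norm_monomial_sq hp α, ← integral_complex_ofReal]
  refine integral_congr_ae (Filter.Eventually.of_forall fun z => ?_)
  simp only
  rw [← Complex.normSq_eq_conj_mul_self, Complex.normSq_eq_norm_sq]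

theorem inner_bergmanMonomial_of_ne {α β : Fin m → ℕ} (h : α ≠ β) :
    inner ℂ (bergmanMonomial hp α) (bergmanMonomial hp β) = 0 := by
  rw [inner_bergmanMonomial hp α _ (bergmanMonomial_ae_eq hp β)]
  obtain ⟨k, hk⟩ := Function.ne_iff.1 h
  -- Rotating coordinate `k` by `ζ` multiplies the inner product by this factor, so it must vanish.
  -- The choice `ζ = exp(i)` works for all exponents, since `π` is irrational and no nonzero integer
  -- is a multiple of `2π`.
  obtain ⟨ζ, hζ1, hζ⟩ : ∃ ζ : ℂ, ‖ζ‖ = 1 ∧ (starRingEnd ℂ) (ζ ^ α k) * ζ ^ β k ≠ 1 := by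
    refine ⟨Complex.exp (Complex.I), by
      simpa using Complex.norm_exp_ofReal_mul_I 1, fun he => ?_⟩
    rw [← Complex.exp_nat_mul, ← Complex.exp_nat_mul, ← Complex.exp_conj, ← Complex.exp_add,
      Complex.exp_eq_one_iff] at he
    obtain ⟨n, hn⟩ := he
    have h1 := congrArg Complex.im hn
    simp at h1
    have h2 : (((β k : ℤ) - α k : ℤ) : ℝ) = n * (2 * Real.pi) := by
      push_cast
      linarith
    rcases eq_or_ne n 0 with hn0 | hn0
    · rw [hn0] at h2
      simp only [Int.cast_zero, zero_mul, Int.cast_eq_zero] at h2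
      omega
    · refine irrational_pi ⟨((β k : ℤ) - α k : ℤ) / (2 * n), ?_⟩
      have hn1 : (n : ℝ) ≠ 0 := by exact_mod_cast hn0
      push_cast at h2 ⊢
      rw [h2]
      field_simp
  set c : Fin m → ℂ := fun j => if j = k then ζ else 1 with hc
  have hc1 : ∀ j, ‖c j‖ = 1 := fun j => by
    simp only [hc]; split_ifs <;> simp [hζ1]
  have hprod : ∀ (γ : Fin m → ℕ) (z : Fin m → ℂ),
      ∏ j, (c * z) j ^ γ j = ζ ^ γ k * ∏ j, z j ^ γ j := by
    intro γ z
    simp only [Pi.mul_apply, mul_pow, Finset.prod_mul_distrib]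
    congr 1
    rw [Finset.prod_eq_single k (fun j _ hj => by simp [hc, hj]) (by simp)]
    simp [hc]
  have hI := setIntegral_comp_torus_mul hc1 (torus_mul_mem_eggDomain_iff hp hc1)
    (fun z => (starRingEnd ℂ) (∏ j, z j ^ α j) * ∏ j, z j ^ β j)
  simp only [hprod, map_mul] at hI
  have hI2 : ∀ z : Fin m → ℂ, (starRingEnd ℂ) (ζ ^ α k) * (starRingEnd ℂ) (∏ j, z j ^ α j) *
      (ζ ^ β k * ∏ j, z j ^ β j) = ((starRingEnd ℂ) (ζ ^ α k) * ζ ^ β k) *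
      ((starRingEnd ℂ) (∏ j, z j ^ α j) * ∏ j, z j ^ β j) := fun z => by ring
  simp only [hI2] at hI
  rw [integral_const_mul] at hI
  by_contra hne
  exact hζ (mul_right_cancel₀ hne (by rw [hI, one_mul]))

/-- The normalised monomials. -/
noncomputable def bergmanUnit (α : Fin m → ℕ) : bergmanSpace (eggDomain p hp) :=
  ((√(monomialNormSq p α))⁻¹ : ℂ) • bergmanMonomial hp α

theorem inner_bergmanUnit_left (α : Fin m → ℕ) (f : bergmanSpace (eggDomain p hp)) :
    inner ℂ (bergmanUnit hp α) f =
      (√(monomialNormSq p α) : ℂ)⁻¹ * inner ℂ (bergmanMonomial hp α) f := by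
  refine (inner_smul_left (𝕜 := ℂ) (bergmanMonomial hp α) f _).trans ?_
  rw [map_inv₀, Complex.conj_ofReal]

theorem inner_bergmanUnit_right (α : Fin m → ℕ) (f : bergmanSpace (eggDomain p hp)) :
    inner ℂ f (bergmanUnit hp α) =
      (√(monomialNormSq p α) : ℂ)⁻¹ * inner ℂ f (bergmanMonomial hp α) :=
  inner_smul_right (𝕜 := ℂ) f (bergmanMonomial hp α) _

theorem orthonormal_bergmanUnit : Orthonormal ℂ (bergmanUnit hp) := by
  rw [orthonormal_iff_ite]
  intro α β
  have h1 : (√(monomialNormSq p α) : ℂ) ≠ 0 := by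
    exact_mod_cast (Real.sqrt_pos.2 (monomialNormSq_pos hp α)).ne'
  rw [inner_bergmanUnit_left, inner_bergmanUnit_right]
  split_ifs with h
  · subst h
    rw [inner_bergmanMonomial_self]
    have h2 : (monomialNormSq p α : ℂ) = √(monomialNormSq p α) * √(monomialNormSq p α) := by
      exact_mod_cast (Real.mul_self_sqrt (monomialNormSq_pos hp α).le).symm
    rw [h2]
    field_simp
  · rw [inner_bergmanMonomial_of_ne hp h, mul_zero, mul_zero]

theorem orthogonal_span_bergmanUnit :
    (Submodule.span ℂ (Set.range (bergmanUnit hp)))ᗮ = ⊥ := by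
  rw [Submodule.eq_bot_iff]
  intro f hf
  obtain ⟨g, hg, hfg⟩ := f.2
  have hmem : MemLp g 2 ((volume : Measure (Fin m → ℂ)).restrict (eggDomain p hp)) :=
    (Lp.memLp f.1).ae_eq hfg
  have h0 := eq_zero_of_integral_monomial_eq_zero (eggDomain p hp).isOpen
    (fun w hw z hz => smul_mem_eggDomain hp hw hz) (isBounded_eggDomain p hp) hg
    (hmem.integrable (by norm_num)) fun α => by
      rw [← inner_bergmanMonomial hp α f hfg]
      have h1 := (Submodule.mem_orthogonal _ _).1 hf _ (Submodule.subset_span ⟨α, rfl⟩)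
      rw [inner_bergmanUnit_left] at h1
      refine (mul_eq_zero.1 h1).resolve_left ?_
      have h2 : (√(monomialNormSq p α) : ℂ) ≠ 0 := by
        exact_mod_cast (Real.sqrt_pos.2 (monomialNormSq_pos hp α)).ne'
      simpa using h2
  refine Subtype.ext (Lp.ext ?_)
  refine hfg.trans (Filter.EventuallyEq.trans h0 (Lp.coeFn_zero ℂ 2 _).symm)

/-- The Hilbert basis of the Bergman space consisting of the normalised monomials. -/
noncomputable def bergmanBasis : HilbertBasis (Fin m → ℕ) ℂ (bergmanSpace (eggDomain p hp)) :=
  HilbertBasis.mkOfOrthogonalEqBot (orthonormal_bergmanUnit hp) (orthogonal_span_bergmanUnit hp)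

/-- The weights of the multishift given by the coordinate multiplications. -/
noncomputable def eggWeight (p : Fin m → ℝ) (j : Fin m) (α : Fin m → ℕ) : ℝ :=
  √(monomialNormSq p (α + Pi.single j 1)) / √(monomialNormSq p α)

theorem coordMul_bergmanMonomial (j : Fin m) (α : Fin m → ℕ) :
    coordMul (eggDomain p hp) (isBounded_eggDomain p hp) j (bergmanMonomial hp α) =
      bergmanMonomial hp (α + Pi.single j 1) := by
  refine Subtype.ext (Lp.ext ?_)
  filter_upwards [coordMul_ae_eq (eggDomain p hp) (isBounded_eggDomain p hp) j
    (bergmanMonomial hp α), bergmanMonomial_ae_eq hp α,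
    bergmanMonomial_ae_eq hp (α + Pi.single j 1)] with z h1 h2 h3
  rw [h1, h2, h3]
  simp only [Pi.add_apply, pow_add, Finset.prod_mul_distrib]
  rw [mul_comm, Finset.prod_eq_single (f := fun i => z i ^ (Pi.single j 1 : Fin m → ℕ) i) j
    (fun i _ hi => by simp [hi]) (by simp)]
  simp

theorem coordMul_bergmanBasis (j : Fin m) (α : Fin m → ℕ) :
    coordMul (eggDomain p hp) (isBounded_eggDomain p hp) j (bergmanBasis hp α) =
      (eggWeight p j α : ℂ) • bergmanBasis hp (α + Pi.single j 1) := by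
  have h1 : (√(monomialNormSq p (α + Pi.single j 1)) : ℂ) ≠ 0 := by
    exact_mod_cast (Real.sqrt_pos.2 (monomialNormSq_pos hp _)).ne'
  rw [bergmanBasis, HilbertBasis.coe_mkOfOrthogonalEqBot, bergmanUnit, bergmanUnit, map_smul,
    coordMul_bergmanMonomial, smul_smul, eggWeight]
  congr 1
  push_cast
  field_simp

theorem commute_coordMul (Ω : TopologicalSpace.Opens (Fin m → ℂ))
    (hΩ : Bornology.IsBounded (Ω : Set (Fin m → ℂ))) (j k : Fin m) :
    Commute (coordMul Ω hΩ j) (coordMul Ω hΩ k) := by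
  refine ContinuousLinearMap.ext fun f => Subtype.ext (Lp.ext ?_)
  rw [mul_apply_eq_comp, mul_apply_eq_comp]
  filter_upwards [coordMul_ae_eq Ω hΩ j (coordMul Ω hΩ k f), coordMul_ae_eq Ω hΩ k f,
    coordMul_ae_eq Ω hΩ k (coordMul Ω hΩ j f), coordMul_ae_eq Ω hΩ j f] with z h1 h2 h3 h4
  rw [h1, h2, h3, h4]
  ring

end MonomialBasis

/-! ### The shift weights as Gamma ratios. -/

section Weights

variable {m : ℕ} {p : Fin m → ℝ}

theorem eggParam_add_single_self (α : Fin m → ℕ) (j : Fin m) :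
    eggParam p (α + Pi.single j 1) j = eggParam p α j + 1 / p j := by
  unfold eggParam
  rw [Pi.add_apply, Pi.single_eq_same, ← add_div]
  push_cast
  ring

theorem eggParam_add_single_of_ne (α : Fin m → ℕ) {i j : Fin m} (h : i ≠ j) :
    eggParam p (α + Pi.single j 1) i = eggParam p α i := by
  unfold eggParam
  rw [Pi.add_apply, Pi.single_eq_of_ne h, add_zero]

theorem sum_eggParam_add_single (α : Fin m → ℕ) (j : Fin m) :
    ∑ i, eggParam p (α + Pi.single j 1) i = (∑ i, eggParam p α i) + 1 / p j := by
  rw [← Finset.add_sum_erase _ _ (Finset.mem_univ j), eggParam_add_single_self,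
    ← Finset.add_sum_erase _ (fun i => eggParam p α i) (Finset.mem_univ j),
    Finset.sum_congr rfl fun i hi => eggParam_add_single_of_ne α (Finset.ne_of_mem_erase hi)]
  ring

theorem eggWeight_nonneg (j : Fin m) (α : Fin m → ℕ) : 0 ≤ eggWeight p j α :=
  div_nonneg (Real.sqrt_nonneg _) (Real.sqrt_nonneg _)

theorem eggWeight_pos (hp : ∀ j, 0 < p j) (j : Fin m) (α : Fin m → ℕ) : 0 < eggWeight p j α :=
  div_pos (Real.sqrt_pos.2 (monomialNormSq_pos hp _)) (Real.sqrt_pos.2 (monomialNormSq_pos hp _))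

theorem eggWeight_sq (hp : ∀ j, 0 < p j) (j : Fin m) (α : Fin m → ℕ) :
    eggWeight p j α ^ 2 =
      gammaRatio (1 / p j) (eggParam p α j) /
        gammaRatio (1 / p j) ((∑ i, eggParam p α i) + 1) := by
  have hS := sum_eggParam_nonneg hp α
  have ha : 0 < 1 / p j := one_div_pos.2 (hp j)
  have h1 : 0 < Real.Gamma ((∑ i, eggParam p α i) + 1) := Real.Gamma_pos_of_pos (by linarith)
  have h2 : 0 < Real.Gamma ((∑ i, eggParam p α i) + 1 + 1 / p j) :=
    Real.Gamma_pos_of_pos (by linarith)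
  have h3 : 0 < Real.Gamma (eggParam p α j) := Real.Gamma_pos_of_pos (eggParam_pos hp α j)
  have h4 : 0 < ∏ i ∈ Finset.univ.erase j, (Real.pi / p i * Real.Gamma (eggParam p α i)) :=
    Finset.prod_pos fun i _ =>
      mul_pos (div_pos Real.pi_pos (hp i)) (Real.Gamma_pos_of_pos (eggParam_pos hp α i))
  have h5 : 0 < Real.pi / p j := div_pos Real.pi_pos (hp j)
  have h6 : p j ≠ 0 := (hp j).ne'
  rw [eggWeight, div_pow, Real.sq_sqrt (monomialNormSq_pos hp _).le,
    Real.sq_sqrt (monomialNormSq_pos hp _).le, monomialNormSq, monomialNormSq,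
    sum_eggParam_add_single, ← Finset.mul_prod_erase _ _ (Finset.mem_univ j),
    ← Finset.mul_prod_erase _ (fun i => Real.pi / p i * Real.Gamma (eggParam p α i))
      (Finset.mem_univ j), eggParam_add_single_self,
    Finset.prod_congr rfl fun i hi => by
      rw [eggParam_add_single_of_ne α (Finset.ne_of_mem_erase hi)], gammaRatio, gammaRatio,
    add_right_comm (∑ i, eggParam p α i)]
  generalize ∏ i ∈ Finset.univ.erase j, (Real.pi / p i * Real.Gamma (eggParam p α i)) = P at h4 ⊢
  field_simp

/-- Both products telescope to `‖z^(α+e_j+e_k)‖ / ‖z^α‖`. -/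
theorem eggWeight_mul_comm (hp : ∀ j, 0 < p j) (j k : Fin m) (α : Fin m → ℕ) :
    eggWeight p k α * eggWeight p j (α + Pi.single k 1) =
      eggWeight p j α * eggWeight p k (α + Pi.single j 1) := by
  have h1 := (Real.sqrt_pos.2 (monomialNormSq_pos hp α)).ne'
  have h2 := (Real.sqrt_pos.2 (monomialNormSq_pos hp (α + Pi.single k 1))).ne'
  have h3 := (Real.sqrt_pos.2 (monomialNormSq_pos hp (α + Pi.single j 1))).ne'
  unfold eggWeight
  rw [add_right_comm]
  field_simp

end Weights

/-! ### Size of the commutator coefficients and their summability. -/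

section CommutatorEstimates

variable {m : ℕ} {p : Fin m → ℝ}

theorem rpow_le_of_comparable {x y K : ℝ} (hx : 0 < x) (hy : 0 < y)
    (hxy : x ≤ K * y) (hyx : y ≤ K * x) (r : ℝ) : x ^ r ≤ K ^ |r| * y ^ r := by
  have hK : 0 < K := pos_of_mul_pos_left (hx.trans_le hxy) hy.le
  rcases le_total 0 r with hr | hr
  · rw [abs_of_nonneg hr, ← Real.mul_rpow hK.le hy.le]
    exact Real.rpow_le_rpow hx.le hxy hr
  · rw [abs_of_nonpos hr, Real.rpow_neg hK.le, ← Real.inv_rpow hK.le,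
      ← Real.mul_rpow (by positivity) hy.le]
    refine Real.rpow_le_rpow_of_nonpos (by positivity) ?_ hr
    rw [inv_mul_le_iff₀ hK]
    exact hyx

theorem gammaRatio_le_gammaRatio {a x y : ℝ} (ha : 0 < a) (hx : 0 < x) (hxy : x < y) :
    gammaRatio a x ≤ gammaRatio a y := by
  have h := one_le_gammaCross ha (sub_pos.2 hxy) hx
  rwa [gammaCross, add_sub_cancel, le_div_iff₀ (gammaRatio_pos ha hx), one_mul] at h

/-- The shifted total weight `1 + ∑ (α_j + 1) / p_j`. -/
noncomputable def eggTotal (p : Fin m → ℝ) (α : Fin m → ℕ) : ℝ := (∑ i, eggParam p α i) + 1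

theorem one_le_eggTotal (hp : ∀ j, 0 < p j) (α : Fin m → ℕ) : 1 ≤ eggTotal p α := by
  have := sum_eggParam_nonneg hp α
  unfold eggTotal
  linarith

theorem eggParam_lt_eggTotal (hp : ∀ j, 0 < p j) (α : Fin m → ℕ) (j : Fin m) :
    eggParam p α j < eggTotal p α := by
  have := Finset.single_le_sum (f := fun i => eggParam p α i)
    (fun i _ => (eggParam_pos hp α i).le) (Finset.mem_univ j)
  unfold eggTotal
  linarith

theorem eggTotal_add_single (α : Fin m → ℕ) (j : Fin m) :
    eggTotal p (α + Pi.single j 1) = eggTotal p α + 1 / p j := by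
  unfold eggTotal
  rw [sum_eggParam_add_single]
  ring

theorem eggTotal_le (hp : ∀ j, 0 < p j) (α : Fin m → ℕ) :
    eggTotal p α ≤ (1 + ∑ i, 1 / p i) * multiWeight α := by
  have h1 : (1 : ℝ) ≤ multiWeight α := by
    unfold multiWeight
    have : (0 : ℝ) ≤ ∑ i, (α i : ℝ) := by positivity
    linarith
  have h2 : ∑ i, eggParam p α i ≤ ∑ i, 1 / p i * multiWeight α := by
    refine Finset.sum_le_sum fun i _ => ?_
    have := hp i
    rw [eggParam, div_mul_eq_mul_div, one_mul]
    gcongr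
    exact succ_le_multiWeight α i
  rw [← Finset.sum_mul] at h2
  unfold eggTotal
  linarith

theorem multiWeight_le (hp : ∀ j, 0 < p j) (α : Fin m → ℕ) :
    multiWeight α ≤ (1 + ∑ i, p i) * eggTotal p α := by
  have h1 := one_le_eggTotal hp α
  have h2 : ∑ i, (α i : ℝ) ≤ ∑ i, p i * eggTotal p α := by
    refine Finset.sum_le_sum fun i _ => ?_
    have h3 := hp i
    have h4 := eggParam_lt_eggTotal hp α i
    rw [eggParam, div_lt_iff₀ h3] at h4
    linarith
  rw [← Finset.sum_mul] at h2
  unfold multiWeight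
  linarith

theorem multiWeight_add_single (α : Fin m → ℕ) (j : Fin m) :
    multiWeight (α + Pi.single j 1) = multiWeight α + 1 := by
  unfold multiWeight
  simp only [Pi.add_apply, Nat.cast_add, Finset.sum_add_distrib]
  rw [Finset.sum_eq_single (f := fun i => ((Pi.single j 1 : Fin m → ℕ) i : ℝ)) j
    (fun i _ hi => by simp [hi]) (by simp)]
  simp
  ring

theorem eggWeight_sq_eq (hp : ∀ j, 0 < p j) (j : Fin m) (α : Fin m → ℕ) :
    eggWeight p j α ^ 2 =
      gammaRatio (1 / p j) (eggParam p α j) / gammaRatio (1 / p j) (eggTotal p α) :=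
  eggWeight_sq hp j α

theorem eggWeight_le_one (hp : ∀ j, 0 < p j) (j : Fin m) (α : Fin m → ℕ) :
    eggWeight p j α ≤ 1 := by
  have ha : 0 < 1 / p j := one_div_pos.2 (hp j)
  rw [← sq_le_one_iff₀ (eggWeight_nonneg j α), eggWeight_sq_eq hp,
    div_le_one (gammaRatio_pos ha (by linarith [one_le_eggTotal hp α]))]
  exact gammaRatio_le_gammaRatio ha (eggParam_pos hp α j) (eggParam_lt_eggTotal hp α j)

/-- The eigenvalues of the self-commutator `[M_{z_j}^*, M_{z_j}]`. -/
noncomputable def selfCommutatorEigenvalue (p : Fin m → ℝ) (j : Fin m) (α : Fin m → ℕ) : ℝ :=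
  -- The case split is needed because truncated subtraction would return `α` itself on the face `α j
  -- = 0`.
  eggWeight p j α ^ 2 - if α j = 0 then 0 else eggWeight p j (α - Pi.single j 1) ^ 2

theorem selfCommutatorEigenvalue_add_single (j : Fin m) (β : Fin m → ℕ) :
    selfCommutatorEigenvalue p j (β + Pi.single j 1) =
      eggWeight p j (β + Pi.single j 1) ^ 2 - eggWeight p j β ^ 2 := by
  rw [selfCommutatorEigenvalue, if_neg (by simp), add_tsub_cancel_right]

theorem selfCommutatorEigenvalue_of_eq_zero {j : Fin m} {α : Fin m → ℕ} (h : α j = 0) :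
    selfCommutatorEigenvalue p j α = eggWeight p j α ^ 2 := by
  rw [selfCommutatorEigenvalue, if_pos h, sub_zero]

theorem selfCommutatorEigenvalue_add_single_eq (hp : ∀ j, 0 < p j) (j : Fin m)
    (β : Fin m → ℕ) :
    selfCommutatorEigenvalue p j (β + Pi.single j 1) =
      gammaRatio (1 / p j) (eggParam p β j + 1 / p j) /
          gammaRatio (1 / p j) (eggTotal p β + 1 / p j) -
        gammaRatio (1 / p j) (eggParam p β j) / gammaRatio (1 / p j) (eggTotal p β) := by
  rw [selfCommutatorEigenvalue_add_single, eggWeight_sq_eq hp, eggWeight_sq_eq hp,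
    eggParam_add_single_self, eggTotal_add_single]

theorem one_div_le_eggParam (hp : ∀ j, 0 < p j) (β : Fin m → ℕ) (j : Fin m) :
    1 / p j ≤ eggParam p β j := by
  have := hp j
  unfold eggParam
  gcongr
  linarith [Nat.cast_nonneg (α := ℝ) (β j)]

theorem exists_abs_selfCommutatorEigenvalue_le (hp : ∀ j, 0 < p j) (j : Fin m) :
    ∃ C, 0 < C ∧ ∀ α : Fin m → ℕ, |selfCommutatorEigenvalue p j α| ≤
      C * (((α j : ℝ) + 1) ^ (1 / p j - 1) * multiWeight α ^ (-(1 / p j))) := by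
  set a := 1 / p j with ha_def
  have ha : 0 < a := one_div_pos.2 (hp j)
  obtain ⟨C₁, hC₁, h₁⟩ := exists_abs_gammaRatio_div_sub_le ha
  obtain ⟨c₂, hc₂, h₂⟩ := exists_le_gammaRatio (x₀ := 1) ha one_pos
  set A := 1 + ∑ i, 1 / p i with hA
  set B := 1 + ∑ i, p i with hB
  have hA1 : 1 ≤ A := by
    have : 0 ≤ ∑ i, 1 / p i := Finset.sum_nonneg fun i _ => (one_div_pos.2 (hp i)).le
    linarith
  have hB1 : 1 ≤ B := by
    have : 0 ≤ ∑ i, p i := Finset.sum_nonneg fun i _ => (hp i).le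
    linarith
  -- `K` compares the total with the weight in both directions, the factor `2` absorbing the shift
  -- from `β` to `β + e_j`. Likewise `K'` below compares `a (β_j+1)` with `β_j + 2`.
  set K := A + 2 * B with hK
  have hK0 : 0 < K := by linarith
  set K' := a + 2 / a with hK'
  have hK'0 : 0 < K' := by positivity
  have hΓ := gammaRatio_pos ha ha
  refine ⟨C₁ * (K' ^ |a - 1| * K ^ |-a|) + gammaRatio a a / c₂ * K ^ |-a|,
    by positivity, fun α => ?_⟩
  have hW := multiWeight_pos α
  have hX : 0 ≤ ((α j : ℝ) + 1) ^ (a - 1) * multiWeight α ^ (-a) := by positivity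
  by_cases hα : α j = 0
  -- On the face no weight is subtracted: `s_j = a` is constant, so only the decay `T^(-a)` remains.
  · have hT : eggTotal p α ^ (-a) ≤ K ^ |-a| * multiWeight α ^ (-a) := by
      refine rpow_le_of_comparable (by linarith [one_le_eggTotal hp α]) hW ?_ ?_ _
      · exact (eggTotal_le hp α).trans (by gcongr; linarith)
      · have := one_le_eggTotal hp α
        exact (multiWeight_le hp α).trans (by gcongr; linarith)
    have hs : eggParam p α j = a := by simp [eggParam, hα, ha_def]
    rw [selfCommutatorEigenvalue_of_eq_zero hα, abs_of_nonneg (sq_nonneg _),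
      eggWeight_sq_eq hp, hs, hα, Nat.cast_zero, zero_add, Real.one_rpow, one_mul]
    have hT0 : 0 < eggTotal p α := by linarith [one_le_eggTotal hp α]
    calc gammaRatio a a / gammaRatio a (eggTotal p α)
        ≤ gammaRatio a a / (c₂ * eggTotal p α ^ a) := by
          gcongr
          exact h₂ _ (one_le_eggTotal hp α)
      _ = gammaRatio a a / c₂ * eggTotal p α ^ (-a) := by
          rw [Real.rpow_neg hT0.le]
          field_simp
      _ ≤ gammaRatio a a / c₂ * (K ^ |-a| * multiWeight α ^ (-a)) := by gcongr
      _ ≤ _ := by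
          rw [add_mul, mul_assoc (gammaRatio a a / c₂)]
          exact le_add_of_nonneg_left (by positivity)
  · obtain ⟨β, rfl⟩ := eq_add_single_of_ne_zero hα
    have hWβ : multiWeight (β + Pi.single j 1) = multiWeight β + 1 := multiWeight_add_single β j
    have hWβ1 : 1 ≤ multiWeight β := by
      have := succ_le_multiWeight β j
      have h0 : (0 : ℝ) ≤ β j := by positivity
      linarith
    have hT1 := one_le_eggTotal hp β
    have hT : eggTotal p β ^ (-a) ≤ K ^ |-a| * multiWeight (β + Pi.single j 1) ^ (-a) := by
      refine rpow_le_of_comparable (by linarith) hW ?_ ?_ _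
      · refine (eggTotal_le hp β).trans ?_
        rw [hWβ]
        exact mul_le_mul (by linarith) (by linarith) (by linarith) hK0.le
      · have h5 := multiWeight_le hp β
        rw [hWβ]
        calc multiWeight β + 1 ≤ 2 * (B * eggTotal p β) := by linarith
          _ ≤ K * eggTotal p β := by
            rw [← mul_assoc]
            gcongr
            linarith
    have hαj : (((β + Pi.single j 1 : Fin m → ℕ) j : ℕ) : ℝ) = β j + 1 := by simp
    have hsβ : eggParam p β j = a * (β j + 1) := by
      unfold eggParam
      rw [ha_def]
      ring
    have hβ0 : (0 : ℝ) ≤ β j := by positivity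
    have hs : eggParam p β j ^ (a - 1) ≤
        K' ^ |a - 1| * ((((β + Pi.single j 1 : Fin m → ℕ) j : ℕ) : ℝ) + 1) ^ (a - 1) := by
      refine rpow_le_of_comparable (eggParam_pos hp β j) (by positivity) ?_ ?_ _
      · rw [hsβ, hαj]
        have : 0 < 2 / a := by positivity
        gcongr <;> linarith
      · rw [hsβ, hαj]
        have : (2 / a) * (a * ((β j : ℝ) + 1)) = 2 * (β j + 1) := by field_simp
        have h6 : 0 ≤ a * (a * ((β j : ℝ) + 1)) := by positivity
        rw [hK', add_mul]
        linarith
    have hmain := h₁ _ _ (one_div_le_eggParam hp β j) hT1 (eggParam_lt_eggTotal hp β j).le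
    rw [← selfCommutatorEigenvalue_add_single_eq hp] at hmain
    have hT0 : 0 < eggTotal p β := by linarith
    have hsp := eggParam_pos hp β j
    calc _ ≤ C₁ * (eggParam p β j ^ (a - 1) * eggTotal p β ^ (-a)) := hmain
      _ ≤ C₁ * ((K' ^ |a - 1| * ((((β + Pi.single j 1 : Fin m → ℕ) j : ℕ) : ℝ) + 1) ^ (a - 1)) *
          (K ^ |-a| * multiWeight (β + Pi.single j 1) ^ (-a))) := by gcongr
      _ = C₁ * (K' ^ |a - 1| * K ^ |-a|) *
          (((((β + Pi.single j 1 : Fin m → ℕ) j : ℕ) : ℝ) + 1) ^ (a - 1) *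
            multiWeight (β + Pi.single j 1) ^ (-a)) := by ring
      _ ≤ _ := by
        gcongr
        exact le_add_of_nonneg_right (by positivity)

theorem summable_selfCommutatorEigenvalue (hp : ∀ j, 0 < p j) (j : Fin m) {q : ℝ}
    (hq : (m : ℝ) < q) (hpq : p j * (m - 1) < q) :
    Summable fun α => |selfCommutatorEigenvalue p j α| ^ q := by
  obtain ⟨C, hC, h⟩ := exists_abs_selfCommutatorEigenvalue_le hp j
  have hq0 : 0 < q := lt_of_le_of_lt (by positivity) hq
  have hs := (summable_mul_multiWeight_rpow j (a := 1 / p j) hq (by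
    rw [div_mul_eq_mul_div, one_mul, lt_div_iff₀ (hp j)]
    linarith)).mul_left (C ^ q)
  refine Summable.of_nonneg_of_le (fun α => by positivity) (fun α => ?_) hs
  have hW := multiWeight_pos α
  refine (Real.rpow_le_rpow (abs_nonneg _) (h α) hq0.le).trans (le_of_eq ?_)
  rw [Real.mul_rpow hC.le (by positivity), Real.mul_rpow (by positivity) (by positivity),
    ← Real.rpow_mul (by positivity), ← Real.rpow_mul hW.le]
  ring_nf

/-- On boxes with `α_j` of size `N` and the other coordinates about `L N`, the eigenvalue is at
least a constant times `N^(a-1) N^(-a) = 1/N`. A second coordinate is needed to make `T` large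
compared with `s_j`. -/
theorem not_summable_selfCommutatorEigenvalue_of_le_dim (hm : 2 ≤ m) (hp : ∀ j, 0 < p j)
    (j : Fin m) {q : ℝ} (hq0 : 0 < q) (hq : q ≤ m) :
    ¬ Summable fun α => |selfCommutatorEigenvalue p j α| ^ q := by
  set a := 1 / p j with ha_def
  have ha : 0 < a := one_div_pos.2 (hp j)
  obtain ⟨c, K, hc, hK, h⟩ := exists_le_gammaRatio_div_sub ha
  obtain ⟨i₀, hi₀⟩ : ∃ i : Fin m, i ≠ j := by
    have : Nontrivial (Fin m) := Fin.nontrivial_iff_two_le.2 hm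
    exact exists_ne j
  -- On the box `s_j ≤ 2 a N` and `T ≥ L N / p i₀`, so this `L` forces `K s_j ≤ T`.
  obtain ⟨L, hL⟩ := exists_nat_ge (2 * a * K * p i₀)
  set A := 1 + ∑ i, 1 / p i with hA
  have hA1 : 1 ≤ A := by
    have : 0 ≤ ∑ i, 1 / p i := Finset.sum_nonneg fun i _ => (one_div_pos.2 (hp i)).le
    linarith
  set D : ℝ := A * (1 + m * (L + 2)) with hD
  have hD0 : 0 < D := by positivity
  set R : ℝ := 2 * a + 1 / a with hR
  have hR0 : 0 < R := by positivity
  refine not_summable_of_le_on_box (j := j) (L := L)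
    (c := (c * ((R ^ |a - 1|)⁻¹ * D ^ (-a))) ^ q) (x := q) (by positivity) hq ?_
  intro N hN α hαN hαN2 hα
  have hN' : (1 : ℝ) ≤ N := by exact_mod_cast hN
  obtain ⟨β, rfl⟩ := eq_add_single_of_ne_zero (α := α) (k := j) (by omega)
  have hβj : (β + Pi.single j 1 : Fin m → ℕ) j = β j + 1 := by simp
  rw [hβj] at hαN hαN2
  have hn1 : (N : ℝ) ≤ β j + 1 := by exact_mod_cast hαN
  have hn2 : (β j : ℝ) + 1 ≤ 2 * N := by exact_mod_cast hαN2.le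
  have hsβ : eggParam p β j = a * (β j + 1) := by
    unfold eggParam
    rw [ha_def]
    ring
  have hother : ∀ i, i ≠ j → (L * N : ℝ) ≤ β i ∧ (β i : ℝ) ≤ L * N + N := by
    intro i hi
    have := hα i hi
    rw [Pi.add_apply, Pi.single_eq_of_ne hi, add_zero] at this
    exact ⟨by exact_mod_cast this.1, by exact_mod_cast this.2.le⟩
  have hT1 := one_le_eggTotal hp β
  have hKs : K * eggParam p β j ≤ eggTotal p β := by
    refine le_trans ?_ (eggParam_lt_eggTotal hp β i₀).le
    have hp0 := hp i₀
    rw [hsβ, eggParam, le_div_iff₀ hp0]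
    calc K * (a * (β j + 1)) * p i₀ ≤ K * (a * (2 * N)) * p i₀ := by gcongr
      _ = 2 * a * K * p i₀ * N := by ring
      _ ≤ L * N := by gcongr
      _ ≤ β i₀ := (hother i₀ hi₀).1
      _ ≤ _ := by linarith
  have hTD : eggTotal p β ≤ D * N := by
    refine (eggTotal_le hp β).trans ?_
    have hsum : ∑ i, (β i : ℝ) ≤ ∑ _i : Fin m, ((L : ℝ) + 2) * N := by
      refine Finset.sum_le_sum fun i _ => ?_
      by_cases hi : i = j
      · subst hi
        have : (0 : ℝ) ≤ L * N := by positivity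
        linarith
      · linarith [(hother i hi).2]
    rw [Finset.sum_const, Finset.card_univ, Fintype.card_fin, nsmul_eq_mul] at hsum
    rw [hD, mul_assoc]
    gcongr
    unfold multiWeight
    linarith
  have hs : (N : ℝ) ^ (a - 1) ≤ R ^ |a - 1| * eggParam p β j ^ (a - 1) := by
    refine rpow_le_of_comparable (by linarith) (eggParam_pos hp β j) ?_ ?_ _
    · rw [hsβ, hR, add_mul]
      have e1 : 1 / a * (a * ((β j : ℝ) + 1)) = β j + 1 := by field_simp
      have e2 : 0 ≤ 2 * a * (a * ((β j : ℝ) + 1)) := by positivity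
      linarith
    · rw [hsβ, hR]
      have e1 : a * ((β j : ℝ) + 1) ≤ a * (2 * N) := by gcongr
      have e2 : 0 ≤ 1 / a * (N : ℝ) := by positivity
      linarith
  have hmain := h _ _ (one_div_le_eggParam hp β j) hT1 hKs
  rw [← selfCommutatorEigenvalue_add_single_eq hp] at hmain
  have hRa : 0 < R ^ |a - 1| := by positivity
  have hlow : c * ((R ^ |a - 1|)⁻¹ * D ^ (-a)) * (N : ℝ)⁻¹ ≤
      |selfCommutatorEigenvalue p j (β + Pi.single j 1)| := by
    refine le_trans ?_ (hmain.trans (le_abs_self _))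
    have hT2 : (D * N) ^ (-a) ≤ eggTotal p β ^ (-a) :=
      Real.rpow_le_rpow_of_nonpos (by linarith) hTD (by linarith)
    have hs2 : (R ^ |a - 1|)⁻¹ * (N : ℝ) ^ (a - 1) ≤ eggParam p β j ^ (a - 1) := by
      rwa [inv_mul_le_iff₀ hRa]
    have hsp := eggParam_pos hp β j
    calc _ = c * (((R ^ |a - 1|)⁻¹ * (N : ℝ) ^ (a - 1)) * (D * N) ^ (-a)) := by
          have hNN : (0 : ℝ) < N := by linarith
          have e : (N : ℝ)⁻¹ = (N : ℝ) ^ (a - 1) * (N : ℝ) ^ (-a) := by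
            rw [← Real.rpow_add hNN, ← Real.rpow_neg_one]
            ring_nf
          rw [Real.mul_rpow hD0.le hNN.le, e]
          ring
      _ ≤ _ := by gcongr
  calc _ = (c * ((R ^ |a - 1|)⁻¹ * D ^ (-a)) * (N : ℝ)⁻¹) ^ q := by
        rw [Real.rpow_neg (by positivity) q, ← Real.inv_rpow (x := (N : ℝ)) (by positivity),
          ← Real.mul_rpow (by positivity) (by positivity)]
    _ ≤ _ := Real.rpow_le_rpow (by positivity) hlow hq0.le

/-- On the face `α_j = 0` the eigenvalue is a squared weight of order `T^(-a)`, summed over `m - 1`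
free coordinates; it diverges when `a q ≤ m - 1`. -/
theorem not_summable_selfCommutatorEigenvalue_of_le_mul (hm : 2 ≤ m) (hp : ∀ j, 0 < p j)
    (j : Fin m) {q : ℝ} (hq0 : 0 < q) (hq : q ≤ p j * (m - 1)) :
    ¬ Summable fun α => |selfCommutatorEigenvalue p j α| ^ q := by
  set a := 1 / p j with ha_def
  have ha : 0 < a := one_div_pos.2 (hp j)
  obtain ⟨C, hC, h⟩ := exists_gammaRatio_le (x₀ := 1) ha one_pos
  set A := 1 + ∑ i, 1 / p i with hA
  have hA1 : 1 ≤ A := by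
    have : 0 ≤ ∑ i, 1 / p i := Finset.sum_nonneg fun i _ => (one_div_pos.2 (hp i)).le
    linarith
  set D : ℝ := A * (1 + m * 2) with hD
  have hD0 : 0 < D := by positivity
  have hΓ := gammaRatio_pos ha ha
  refine not_summable_of_le_on_face (j := j) hm (c := (gammaRatio a a / (C * D ^ a)) ^ q)
    (x := a * q) (by positivity) ?_ ?_
  · rw [ha_def, div_mul_eq_mul_div, one_mul, div_le_iff₀ (hp j)]
    linarith
  intro N hN α hαj hα
  have hN' : (1 : ℝ) ≤ N := by exact_mod_cast hN
  have hT1 := one_le_eggTotal hp α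
  have hTD : eggTotal p α ≤ D * N := by
    refine (eggTotal_le hp α).trans ?_
    have hsum : ∑ i, (α i : ℝ) ≤ ∑ _i : Fin m, 2 * (N : ℝ) := by
      refine Finset.sum_le_sum fun i _ => ?_
      by_cases hi : i = j
      · subst hi
        rw [hαj, Nat.cast_zero]
        positivity
      · exact_mod_cast (hα i hi).2.le
    rw [Finset.sum_const, Finset.card_univ, Fintype.card_fin, nsmul_eq_mul] at hsum
    rw [hD, mul_assoc]
    gcongr
    unfold multiWeight
    linarith
  have hs : eggParam p α j = a := by simp [eggParam, hαj, ha_def]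
  have hlow : gammaRatio a a / (C * D ^ a) * (N : ℝ) ^ (-a) ≤
      |selfCommutatorEigenvalue p j α| := by
    rw [selfCommutatorEigenvalue_of_eq_zero hαj, abs_of_nonneg (sq_nonneg _),
      eggWeight_sq_eq hp, hs]
    have hNN : (0 : ℝ) < N := by linarith
    calc _ = gammaRatio a a / (C * (D * N) ^ a) := by
          rw [Real.mul_rpow hD0.le hNN.le, Real.rpow_neg hNN.le]
          field_simp
      _ ≤ _ := by
        have := gammaRatio_pos ha (show 0 < eggTotal p α by linarith)
        gcongr
        refine (h _ hT1).trans ?_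
        gcongr
  calc _ = (gammaRatio a a / (C * D ^ a) * (N : ℝ) ^ (-a)) ^ q := by
        rw [← neg_mul, Real.rpow_mul (by positivity),
          ← Real.mul_rpow (by positivity) (by positivity)]
    _ ≤ _ := Real.rpow_le_rpow (by positivity) hlow hq0.le

/-- With one variable `T = s + 1`, and the functional equation reduces the squared weight to
`s/(s+a) = (n+1)/(n+2)`. -/
theorem selfCommutatorEigenvalue_of_dim_one {p : Fin 1 → ℝ} (hp : ∀ j, 0 < p j) (j : Fin 1)
    (α : Fin 1 → ℕ) :
    selfCommutatorEigenvalue p j α = (((α j : ℝ) + 1) * ((α j : ℝ) + 2))⁻¹ := by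
  have hpj := hp j
  have hw : ∀ α : Fin 1 → ℕ, eggWeight p j α ^ 2 = ((α j : ℝ) + 1) / (α j + 2) := by
    intro α
    have ha : 0 < 1 / p j := one_div_pos.2 hpj
    have hs := eggParam_pos hp α j
    have hT : eggTotal p α = eggParam p α j + 1 := by
      rw [eggTotal, Finset.univ_unique, Finset.sum_singleton, Subsingleton.elim default j]
    have hP := gammaRatio_pos ha hs
    rw [eggWeight_sq_eq hp, hT, gammaRatio_succ ha hs, ← div_div, div_self hP.ne', one_div_div,
      eggParam, ← add_div, div_div_div_cancel_right₀ hpj.ne', add_assoc]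
    norm_num
  by_cases hα : α j = 0
  · rw [selfCommutatorEigenvalue_of_eq_zero hα, hw, hα]
    norm_num
  · obtain ⟨β, rfl⟩ := eq_add_single_of_ne_zero hα
    rw [selfCommutatorEigenvalue_add_single, hw, hw]
    simp only [Pi.add_apply, Pi.single_eq_same, Nat.cast_add, Nat.cast_one]
    field_simp
    ring

theorem summable_selfCommutatorEigenvalue_dim_one_iff {p : Fin 1 → ℝ} (hp : ∀ j, 0 < p j)
    (j : Fin 1) {q : ℝ} (hq0 : 0 < q) :
    (Summable fun α => |selfCommutatorEigenvalue p j α| ^ q) ↔ 1 / 2 < q := by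
  simp_rw [selfCommutatorEigenvalue_of_dim_one hp]
  constructor
  · intro hs
    by_contra hq
    push Not at hq
    -- `n + 1 ≤ 2N` gives `(n+1)(n+2) ≤ 6 N²`; `L` plays no role as there is no other coordinate.
    refine not_summable_of_le_on_box (j := j) (L := 1) (c := (6⁻¹ : ℝ) ^ q) (x := 2 * q)
      (by positivity) (by push_cast; linarith) ?_ hs
    intro N hN α hα1 hα2 _
    have hN' : (1 : ℝ) ≤ N := by exact_mod_cast hN
    have h1 : (α j : ℝ) + 1 ≤ 2 * N := by exact_mod_cast hα2
    rw [Real.rpow_neg (by positivity), Real.rpow_mul (by positivity), ← Real.inv_rpow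
      (by positivity), ← Real.mul_rpow (by positivity) (by positivity), abs_of_pos (by positivity)]
    refine Real.rpow_le_rpow (by positivity) ?_ hq0.le
    rw [← mul_inv]
    refine inv_anti₀ (by positivity) ?_
    rw [Real.rpow_two]
    nlinarith
  · intro hq
    refine Summable.of_nonneg_of_le (fun α => by positivity) (fun α => ?_)
      (summable_multiWeight_rpow one_pos (q := 2 * q) (by push_cast; linarith))
    have hW : multiWeight α = α j + 1 := by
      rw [multiWeight, Finset.univ_unique, Finset.sum_singleton, add_comm,
        Subsingleton.elim default j]
    rw [hW, Real.rpow_neg (by positivity), Real.rpow_mul (by positivity), ← Real.inv_rpow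
      (by positivity), abs_of_pos (by positivity)]
    refine Real.rpow_le_rpow (by positivity) ?_ hq0.le
    gcongr
    rw [Real.rpow_two]
    nlinarith

/-- Since `k ≠ j`, adding `e_k` changes `T` but not `s_j`, so the two products of weights differ by
the single factor `Ξ = 1 + O(1/T)`. As weights are at most `1`, the difference is `O(1/T)`. -/
theorem summable_crossCommutator_weights (hp : ∀ j, 0 < p j) {j k : Fin m} (hjk : j ≠ k) {q : ℝ}
    (hq : (m : ℝ) < q) :
    Summable fun β : Fin m → ℕ => |eggWeight p k β * eggWeight p j β -
      eggWeight p j (β + Pi.single k 1) * eggWeight p k (β + Pi.single j 1)| ^ q := by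
  have ha : 0 < 1 / p j := one_div_pos.2 (hp j)
  have hb : 0 < 1 / p k := one_div_pos.2 (hp k)
  have hq0 : 0 < q := lt_of_le_of_lt (by positivity) hq
  obtain ⟨C, hC, h⟩ := exists_gammaCross_le (x₀ := 1) ha hb one_pos
  set B := 1 + ∑ i, p i with hB
  have hB1 : 1 ≤ B := by
    have : 0 ≤ ∑ i, p i := Finset.sum_nonneg fun i _ => (hp i).le
    linarith
  refine Summable.of_nonneg_of_le (fun α => by positivity) (fun β => ?_)
    ((summable_multiWeight_rpow j.pos hq).mul_left ((C * B) ^ q))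
  have hT1 := one_le_eggTotal hp β
  have hT0 : 0 < eggTotal p β := by linarith
  have hW := multiWeight_pos β
  set Ξ := gammaCross (1 / p j) (1 / p k) (eggTotal p β) with hΞ
  have hΞ1 : 1 ≤ Ξ := one_le_gammaCross ha hb hT0
  have hw1 := eggWeight_pos hp j (β + Pi.single k 1)
  have hw2 := eggWeight_pos hp k (β + Pi.single j 1)
  have hsq : eggWeight p j β ^ 2 = eggWeight p j (β + Pi.single k 1) ^ 2 * Ξ := by
    have h1 := gammaRatio_pos ha hT0
    have h2 := gammaRatio_pos ha (show 0 < eggTotal p β + 1 / p k by positivity)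
    rw [eggWeight_sq_eq hp, eggWeight_sq_eq hp, eggTotal_add_single,
      eggParam_add_single_of_ne β hjk, hΞ, gammaCross]
    field_simp
  have hX : eggWeight p k β * eggWeight p j β =
      eggWeight p j (β + Pi.single k 1) * eggWeight p k (β + Pi.single j 1) * Ξ := by
    refine mul_right_cancel₀ hw1.ne' ?_
    calc _ = eggWeight p j β * (eggWeight p k β * eggWeight p j (β + Pi.single k 1)) := by ring
      _ = eggWeight p j β ^ 2 * eggWeight p k (β + Pi.single j 1) := by
        rw [eggWeight_mul_comm hp]; ring
      _ = _ := by rw [hsq]; ring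
  have hle : |eggWeight p k β * eggWeight p j β -
      eggWeight p j (β + Pi.single k 1) * eggWeight p k (β + Pi.single j 1)| ≤
      C * B * (multiWeight β)⁻¹ := by
    rw [hX, ← mul_sub_one, abs_of_nonneg (mul_nonneg (by positivity) (by linarith))]
    calc _ ≤ 1 * (Ξ - 1) := by
          refine mul_le_mul_of_nonneg_right ?_ (by linarith)
          exact mul_le_one₀ (eggWeight_le_one hp _ _) hw2.le (eggWeight_le_one hp _ _)
      _ ≤ C / eggTotal p β := by linarith [h _ hT1]
      _ ≤ _ := by
        rw [mul_assoc, ← div_eq_mul_inv B, div_eq_mul_inv C]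
        refine mul_le_mul_of_nonneg_left ?_ hC.le
        rw [le_div_iff₀ hW, inv_mul_le_iff₀ hT0, mul_comm]
        exact multiWeight_le hp β
  calc _ ≤ (C * B * (multiWeight β)⁻¹) ^ q := Real.rpow_le_rpow (abs_nonneg _) hle hq0.le
    _ = _ := by
      rw [Real.mul_rpow (by positivity) (by positivity), Real.inv_rpow hW.le, Real.rpow_neg hW.le]

theorem isEssentiallyNormal_coordMul_iff (hp : ∀ j, 0 < p j) {q : ℝ} :
    IsEssentiallyNormal q (coordMul (eggDomain p hp) (isBounded_eggDomain p hp)) ↔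
      ∀ j k, IsSchattenSummable q
        (crossCommutator (coordMul (eggDomain p hp) (isBounded_eggDomain p hp)) j k) :=
  ⟨fun h => h.2, fun h => ⟨commute_coordMul _ _, h⟩⟩

theorem isSchattenSummable_selfCommutator_iff (hp : ∀ j, 0 < p j) {q : ℝ} (hq : 0 < q)
    (j : Fin m) :
    IsSchattenSummable q
        (crossCommutator (coordMul (eggDomain p hp) (isBounded_eggDomain p hp)) j j) ↔
      Summable fun α => |selfCommutatorEigenvalue p j α| ^ q :=
  isSchattenSummable_crossCommutator_self_iff (coordMul_bergmanBasis hp) hq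
    (selfCommutatorEigenvalue_add_single j) fun _ h => selfCommutatorEigenvalue_of_eq_zero h

end CommutatorEstimates

/-! ### The criterion. -/

theorem theorem1 (m : ℕ) (hm : 1 ≤ m) (p : Fin m → ℝ) (hp : ∀ j, 0 < p j) (q : ℝ) (hq : 0 < q) :
    IsEssentiallyNormal q (coordMul (eggDomain p hp) (isBounded_eggDomain p hp)) ↔
      (if m = 1 then (1 / 2 : ℝ) else max (m : ℝ) (⨆ j, p j * ((m : ℝ) - 1))) < q := by
  rw [isEssentiallyNormal_coordMul_iff hp]
  split_ifs with h1
  · subst h1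
    rw [← summable_selfCommutatorEigenvalue_dim_one_iff hp 0 hq,
      ← isSchattenSummable_selfCommutator_iff hp hq]
    refine ⟨fun h => h 0 0, fun h j k => ?_⟩
    rwa [Subsingleton.elim j 0, Subsingleton.elim k 0]
  · have hm2 : 2 ≤ m := by omega
    have : Nonempty (Fin m) := ⟨⟨0, by omega⟩⟩
    rw [max_lt_iff]
    constructor
    · intro h
      have hs := fun j => (isSchattenSummable_selfCommutator_iff hp hq j).1 (h j j)
      -- An index attaining the supremum serves for both bounds; the one by `m` would follow from
      -- any index.
      obtain ⟨j, hj⟩ := exists_eq_ciSup_of_finite (f := fun j => p j * ((m : ℝ) - 1))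
      rw [← hj]
      constructor
      · by_contra hle
        exact not_summable_selfCommutatorEigenvalue_of_le_dim hm2 hp j hq (not_lt.1 hle) (hs j)
      · by_contra hle
        exact not_summable_selfCommutatorEigenvalue_of_le_mul hm2 hp j hq (not_lt.1 hle) (hs j)
    · rintro ⟨hmq, hsup⟩ j k
      by_cases hjk : j = k
      · subst hjk
        rw [isSchattenSummable_selfCommutator_iff hp hq]
        refine summable_selfCommutatorEigenvalue hp j hmq (lt_of_le_of_lt ?_ hsup)
        exact le_ciSup (f := fun j => p j * ((m : ℝ) - 1)) (Set.finite_range _).bddAbove j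
      · exact isSchattenSummable_crossCommutator_of_ne (coordMul_bergmanBasis hp) hq
          (Ne.symm hjk) (summable_crossCommutator_weights hp (Ne.symm hjk) hmq)
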